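/- **Setting.** Let $N,d,T\ge 1$ and let $C_i=\{\mathbf x_i^1,\mathbf x_i^2\}\subset\mathbb R^d$, $i\in[N]$, be codebooks with two distinct codewords each; put $d_i:=\Vert \mathbf x_i^1-\mathbf x_i^2\Vert_2>0$. Let $Z_1,\dots,Z_T$ be random vectors in $\mathbb R^d$, arbitrarily dependent on each other, with $Z_t\sim\mathcal N(0,\sigma_{Z_t}^2\mathbf I)$ and $\sigma_{Z_t}>0$ for all $t\in[T]$; $\sigma_{Z_0}$ is an arbitrary real number. For the noise $Z_t$ the loss of the $i$-th codebook is its symbol error rate $$\boldsymbol\ell_{t,i}=\ell_t(C_i)=\tfrac12\sum_{j=1}^2\mathbb 1\Big\{\min_{j'\ne j}\Vert\mathbf x_i^{j'}-(\mathbf x_i^j+Z_t)\Vert_2^2\le\Vert\mathbf x_i^{j}-(\mathbf x_i^j+Z_t)\Vert_2^2\Big\},$$ and $\boldsymbol\ell_{0,i}:=0$. **Algorithm.** In round $t\in[T]$ an index $i_t\in[N]$ is drawn from a distribution $\mathbf w_t$ on $[N]$, that is, $\mathbf w_t$ is the conditional law of $i_t$ given $Z_1,\dots,Z_T,i_1,\dots,i_{t-1}$,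 and the codebook $C_{i_t}$ is used. Let $\psi_\eta(\mathbf w)=\frac1\eta\sum_{i}\ln\frac1{\mathbf w_i}$ be the log-barrier on the probability simplex $\Omega$, with Bregman divergence $\mathcal B_{\psi_\eta}$. With the hint $\mathbf m_{t,i}=\boldsymbol\ell_{\alpha_i(t),i}$, $\alpha_i(t)=\max\{\tau\in[t-1]:i_\tau=i\}$ (or $0$ if there is no such $\tau$), and the estimator $\hat{\boldsymbol\ell}_{t,i}=\frac{\boldsymbol\ell_{t,i}-\mathbf m_{t,i}}{\mathbf w_{t,i}}\mathbb 1\{i_t=i\}+\mathbf m_{t,i}$, the iterates are $$\mathbf w_t=\arg\min_{\mathbf w\in\Omega}\{\langle\mathbf w,\mathbf m_t\rangle+\mathcal B_{\psi_{\eta_t}}(\mathbf w,\mathbf w'_t)\},\qquad \mathbf w'_{t+1}=\arg\min_{\mathbf w\in\Omega}\{\langle\mathbf w,\hat{\boldsymbol\ell}_t\rangle+\mathcal B_{\psi_{\eta_t}}(\mathbf w,\mathbf w'_t)\},$$ starting from $\mathbf w'_1=\arg\min_\Omega\psi_{\eta_1}$ and $\eta_1=\eta_0\in(0,\frac1{162}]$.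 The learning rate follows the doubling trick: if at the end of round $t$ of an epoch that began in round $s$ we have $\sum_{\tau=s}^t\sum_i\mathbf w_{\tau,i}^2(\hat{\boldsymbol\ell}_{\tau,i}-\mathbf m_{\tau,i})^2\ge\frac{N\ln T}{3\eta_t^2}$, a new epoch begins in round $t+1$, with $\eta_{t+1}=\eta_t/2$ and $\mathbf w'_{t+1}=\arg\min_\Omega\psi_{\eta_{t+1}}$; otherwise $\eta_{t+1}=\eta_t$. **Claim.** Write $C_t$ for the codebook $C_{i_t}$ selected in round $t$, $\mathbf x_t^j$ ($j=1,2$) for its codewords, and $\mathbf y_t^j=\mathbf x_t^j+Z_t$. Let $$\mathbb P_t(C_t)=\tfrac12\sum_{j=1}^2 P\Big\{\min_{j'\ne j}\Vert\mathbf x_t^{j'}-\mathbf y_t^j\Vert_2^2<\Vert\mathbf x_t^{j}-\mathbf y_t^j\Vert_2^2\Big\},$$ where the probability is over the noise and the algorithm, and let $C^*$ be a codebook that minimises $\sum_{t\in[T]}\ell_t(C_i)$ in hindsight. Let $Q(x)=\int_x^\infty\frac1{\sqrt{2\pi}}e^{-\tau^2/2}\,d\tau$. Then for every $\eta_0\in(0,\frac1{162}]$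 there are constants $c>0$ and $k\in\mathbb N$, independent of $N,d,T$, the codebooks and the noise, such that $$\frac1T\sum_{t\in[T]}\mathbb P_t(C_t)-\frac1T\sum_{t\in[T]}\mathbb E[\ell_t(C^*)]\le c\,(1+\ln T)^k\Bigg(\frac1T\sqrt{\sum_{i\in[N]}\sum_{t\in[T]}\sqrt{Q\Big(\frac{d_i}{2\sigma_{Z_t}}\Big)\Big(1-Q\Big(\frac{d_i}{2\sigma_{Z_t}}\Big)\Big)}}+\frac1T\sqrt{\sum_{i\in[N]}\sum_{t\in[T]}\big|\sigma_{Z_t}-\sigma_{Z_{t-1}}\big|}\Bigg).$$ -/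

import Mathlib

open MeasureTheory ProbabilityTheory

noncomputable section

namespace CodebookBandit

/-! ### Codebooks, symbol error rates and the Gaussian tail -/

/-- Signal space `ℝ^d` with the Euclidean norm. -/
abbrev Signal (d : ℕ) := EuclideanSpace ℝ (Fin d)

/-- A codebook with `M` codewords in `ℝ^d`. -/
abbrev Codebook (M d : ℕ) := Fin M → Signal d

/-- When `x^j` is sent and the noise is `z`, so that `y = x^j + z` is received, the nearest competing
codeword is at least as close to `y` as `x^j` is. (The minimum over the finitely many `j' ≠ j` is
attained, so comparing `x^j` with the best competitor is comparing it with some competitor.) -/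
def Misclassified {M d : ℕ} (x : Codebook M d) (j : Fin M) (z : Signal d) : Prop :=
  ∃ j', j' ≠ j ∧ ‖x j' - (x j + z)‖ ^ 2 ≤ ‖x j - (x j + z)‖ ^ 2

/-- The same event with a strictly closer competitor. -/
def StrictlyMisclassified {M d : ℕ} (x : Codebook M d) (j : Fin M) (z : Signal d) : Prop :=
  ∃ j', j' ≠ j ∧ ‖x j' - (x j + z)‖ ^ 2 < ‖x j - (x j + z)‖ ^ 2

open Classical in
/-- Symbol error rate of the codebook `x` on the training sequence under the noise `z`. -/
def symbolErrorRate {M d : ℕ} (x : Codebook M d) (z : Signal d) : ℝ :=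
  (1 / (M : ℝ)) * ∑ j, if Misclassified x j z then (1 : ℝ) else 0

/-- Expected error probability of a (randomly selected) codebook `C` under the noise `Z`: the
average over the codewords of the probability that a competitor is strictly closer to the channel
output. The probability is over everything that is random. -/
def expectedErrorProb {M d : ℕ} {Ω : Type*} [MeasurableSpace Ω] (μ : Measure Ω)
    (C : Ω → Codebook M d) (Z : Ω → Signal d) : ℝ :=
  (1 / (M : ℝ)) * ∑ j, μ.real {ω | StrictlyMisclassified (C ω) j (Z ω)}

/-- The tail function of the standard normal law. -/
def gaussianQ (x : ℝ) : ℝ :=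
  ∫ τ in Set.Ioi x, (1 / Real.sqrt (2 * Real.pi)) * Real.exp (-τ ^ 2 / 2)

/-! ### Optimistic online mirror descent with the log-barrier -/

/-- The points of the probability simplex with positive coordinates: the set on which the
log-barrier is finite. (On the rest of the simplex it is `+∞`, so minimising over the simplex
is minimising over this set.) -/
def positiveSimplex (N : ℕ) : Set (Fin N → ℝ) :=
  stdSimplex ℝ (Fin N) ∩ {w | ∀ i, 0 < w i}

/-- The log-barrier regularizer with learning rate `η`. -/
def logBarrier {N : ℕ} (η : ℝ) (w : Fin N → ℝ) : ℝ :=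
  ∑ i, (1 / η) * Real.log (1 / w i)

/-- The Bregman divergence of `ψ`. -/
def bregman {N : ℕ} (ψ : (Fin N → ℝ) → ℝ) (w u : Fin N → ℝ) : ℝ :=
  ψ w - ψ u - fderiv ℝ ψ u (w - u)

/-- `w` minimises `f` over the simplex. -/
def IsArgmin {N : ℕ} (f : (Fin N → ℝ) → ℝ) (w : Fin N → ℝ) : Prop :=
  w ∈ positiveSimplex N ∧ IsMinOn f (positiveSimplex N) w

/-- The mirror step `argmin_w ⟨w, g⟩ + B_ψ(w, u)` for the log-barrier with learning rate `η`. -/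
def IsMirrorStep {N : ℕ} (η : ℝ) (g u w : Fin N → ℝ) : Prop :=
  IsArgmin (fun v => ∑ i, v i * g i + bregman (logBarrier η) v u) w

/-- The most recent round in `1, …, t - 1` in which `i` was chosen, and `0` if there is none. -/
def lastChosen {N : ℕ} (I : ℕ → Fin N) (i : Fin N) (t : ℕ) : ℕ :=
  ((Finset.Ico 1 t).filter fun τ => I τ = i).sup id

/-- The hint: the most recent observed loss of `i`, with the convention that the loss vector of
the fictitious round `0` is zero. -/
def hint {N : ℕ} (ℓ : ℕ → Fin N → ℝ) (I : ℕ → Fin N) (t : ℕ) (i : Fin N) : ℝ :=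
  if lastChosen I i t = 0 then 0 else ℓ (lastChosen I i t) i

/-- The loss estimator. -/
def lossEstimator {N : ℕ} (ℓ : ℕ → Fin N → ℝ) (I : ℕ → Fin N) (w : ℕ → Fin N → ℝ)
    (t : ℕ) (i : Fin N) : ℝ :=
  (ℓ t i - hint ℓ I t i) / w t i * (if I t = i then 1 else 0) + hint ℓ I t i

/-- The doubling test at the end of round `t` of an epoch that began in round `s`: the accumulated
observed deviation `∑ w² (ℓ̂ - m)²` of the epoch has reached `N ln T / (3 η²)`. -/
def EpochOver {N : ℕ} (T : ℕ) (η : ℝ) (s : ℕ) (ℓ : ℕ → Fin N → ℝ) (I : ℕ → Fin N)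
    (w : ℕ → Fin N → ℝ) (t : ℕ) : Prop :=
  (N : ℝ) * Real.log T / (3 * η ^ 2) ≤
    ∑ τ ∈ Finset.Icc s t, ∑ i, w τ i ^ 2 * (lossEstimator ℓ I w τ i - hint ℓ I τ i) ^ 2

/-- `(w, w', η, s)` is the trajectory over the rounds `1, …, T` of optimistic online mirror descent
with the log-barrier and the doubling trick, for the losses `ℓ` and the choices `I`.
Here `w t` is the sampling distribution of round `t`, `w' t` the auxiliary iterate, `η t` the
learning rate and `s t` the first round of the current epoch. The learning rate starts at `η₀`; when
the doubling test succeeds, it is halved and the auxiliary iterate restarts at the minimiser of the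
regularizer. -/
structure IsOptimisticOMD {N : ℕ} (η₀ : ℝ) (T : ℕ) (ℓ : ℕ → Fin N → ℝ) (I : ℕ → Fin N)
    (w w' : ℕ → Fin N → ℝ) (η : ℕ → ℝ) (s : ℕ → ℕ) : Prop where
  rate_one : η 1 = η₀
  epoch_one : s 1 = 1
  aux_one : IsArgmin (logBarrier (η 1)) (w' 1)
  action : ∀ t ∈ Finset.Icc 1 T, IsMirrorStep (η t) (hint ℓ I t) (w' t) (w t)
  restart : ∀ t ∈ Finset.Icc 1 T, EpochOver T (η t) (s t) ℓ I w t →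
    η (t + 1) = η t / 2 ∧ s (t + 1) = t + 1 ∧
      IsArgmin (logBarrier (η (t + 1))) (w' (t + 1))
  continuation : ∀ t ∈ Finset.Icc 1 T, ¬ EpochOver T (η t) (s t) ℓ I w t →
    η (t + 1) = η t ∧ s (t + 1) = s t ∧
      IsMirrorStep (η t) (lossEstimator ℓ I w t) (w' t) (w' (t + 1))

/-- The information generated by the noise of all rounds and by the choices made before round `t`.
A codebook drawn from `w t` by the private randomness of the algorithm, of which the noise is
independent, has conditional law `w t` given this information. -/
abbrev noiseAndPast {d N : ℕ} {Ω : Type*} (T : ℕ) (Z : ℕ → Ω → Signal d) (I : ℕ → Ω → Fin N)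
    (t : ℕ) : MeasurableSpace Ω :=
  (⨆ τ ∈ Finset.Icc 1 T, MeasurableSpace.comap (Z τ) inferInstance) ⊔
    (⨆ τ ∈ Finset.Ico 1 t, MeasurableSpace.comap (I τ) inferInstance)

/-- The losses of all codebooks of the super-codebook `x` along the noise sequence `z`. -/
def lossSeq {M d N : ℕ} (x : Fin N → Codebook M d) (z : ℕ → Signal d) (t : ℕ) (i : Fin N) : ℝ :=
  symbolErrorRate (x i) (z t)

/-- The algorithm, run on the super-codebook `x` and the noise `Z`, selects the codebooks with
indices `I 1, …, I T`, the index of round `t` being drawn from the distribution `w t`. -/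
structure IsCodebookLearner {M d N : ℕ} {Ω : Type*} [MeasurableSpace Ω] (μ : Measure Ω) (η₀ : ℝ)
    (T : ℕ) (x : Fin N → Codebook M d) (Z : ℕ → Ω → Signal d) (I : ℕ → Ω → Fin N)
    (w w' : ℕ → Ω → Fin N → ℝ) (η : ℕ → Ω → ℝ) (s : ℕ → Ω → ℕ) : Prop where
  measurable_choice : ∀ t ∈ Finset.Icc 1 T, Measurable (I t)
  trajectory : ∀ ω, IsOptimisticOMD η₀ T (lossSeq x (Z · ω)) (I · ω) (w · ω) (w' · ω)
    (η · ω) (s · ω)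
  sampling : ∀ t ∈ Finset.Icc 1 T, ∀ i,
    μ[fun ω => if I t ω = i then (1 : ℝ) else 0 | noiseAndPast T Z I t] =ᵐ[μ] fun ω => w t ω i

end CodebookBandit

end

/-! The bound is a small-loss bound. Let `A` be the expected loss of the algorithm, `B` that of the
comparator and `S` the expected loss summed over all codebooks and rounds. It is proved that `A - B`
is at most a constant times `(1 + log T) * √S`; the path-length term on the right-hand side only has
to be nonnegative.

The standard analysis of the log-barrier bounds the estimated regret by `N log T / η` plus `η` times
the sum of the squared deviations of observed losses from hints. Two facts turn this into a bound in
terms of `A`. With two codewords a loss never exceeds `1/2`, and each observed loss serves as the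
hint of at most one later observation; hence the squared deviations sum to at most the incurred loss
(`sum_deviation_sq_le`). The doubling trick then gives regret of order `N log T / η₀ + κ N log T + A
/ κ` for every `κ > 0`; being linear in the loss, this passes to expectations.

A second comparison bounds `A`. Every restart is at the uniform distribution, so that comparator
pays no divergence at all: `A - S / N ≤ 2 η₀ A`, and therefore `A ≤ 2 S / N`
(`sum_integral_loss_le`). If `√S ≤ N`, this alone gives `A ≤ 2 √S`. Otherwise `N < √S` absorbs the
additive `N log T`, and `κ = √S / N` balances the rest (`le_mul_sqrt_of_min_bounds`).

Finally, the expected loss of a codebook is exactly `Q(d_i / (2 σ_t))`, the probability that the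
noise crosses the perpendicular bisector of the codewords, and `Q ≤ 1/2` gives `Q ≤ √(Q (1 - Q))`.
Only the marginal laws of the noise enter here, while the sampling argument conditions on the whole
noise sequence, so dependence between rounds does no harm. -/

noncomputable section

namespace CodebookBandit

/-! ### Optimality conditions for the mirror steps -/

section FirstOrder

variable {N : ℕ}

lemma IsArgmin.apply_single_eq {f : (Fin N → ℝ) → ℝ} {w : Fin N → ℝ} {f' : (Fin N → ℝ) →L[ℝ] ℝ}
    (h : IsArgmin f w) (hf : HasFDerivAt f f' w) (i j : Fin N) :
    f' (Pi.single i 1) = f' (Pi.single j 1) := by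
  obtain ⟨⟨⟨_, hsum⟩, hpos⟩, hmin⟩ := h
  set v : Fin N → ℝ := Pi.single i 1 - Pi.single j 1 with hv
  have hvs : ∑ k, v k = 0 := by simp [hv]
  -- The minimiser has positive coordinates, so it can move both ways along `e_i - e_j` and the
  -- directional derivative vanishes.
  have hmem : ∀ᶠ r : ℝ in nhds 0, w + r • v ∈ positiveSimplex N := by
    have hev : ∀ᶠ r : ℝ in nhds 0, ∀ k, 0 < (w + r • v) k := by
      rw [Filter.eventually_all]
      intro k
      have hc : Continuous fun r : ℝ => (w + r • v) k := by
        simp only [Pi.add_apply, Pi.smul_apply]; fun_prop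
      refine hc.continuousAt.eventually (lt_mem_nhds ?_)
      simpa using hpos k
    filter_upwards [hev] with r hr
    refine ⟨⟨fun k => (hr k).le, ?_⟩, hr⟩
    simp [Finset.sum_add_distrib, ← Finset.mul_sum, hvs, hsum]
  have hloc : IsLocalMin (fun r : ℝ => f (w + r • v)) 0 := by
    filter_upwards [hmem] with r hr
    simpa using hmin hr
  have hline : HasDerivAt (fun r : ℝ => w + r • v) v 0 := by
    simpa using ((hasDerivAt_id (0 : ℝ)).smul_const v).const_add w
  have hd : HasDerivAt (fun r : ℝ => f (w + r • v)) (f' v) 0 :=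
    HasFDerivAt.comp_hasDerivAt (f := fun r : ℝ => w + r • v) 0 (by simpa using hf) hline
  have h0 := hloc.hasDerivAt_eq_zero hd
  rw [hv, map_sub, sub_eq_zero] at h0
  exact h0

lemma hasFDerivAt_logBarrier (η : ℝ) {w : Fin N → ℝ} (hw : ∀ i, w i ≠ 0) :
    HasFDerivAt (logBarrier η)
      (∑ i, (-(1 / η) * (1 / w i)) • ContinuousLinearMap.proj (R := ℝ) (φ := fun _ : Fin N => ℝ) i)
      w := by
  have : logBarrier (N := N) η = fun v => ∑ i, -(1 / η) * Real.log (v i) := by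
    funext v
    simp [logBarrier, Real.log_inv]
  rw [this]
  refine HasFDerivAt.fun_sum fun i _ => ?_
  have h := (((ContinuousLinearMap.proj (R := ℝ) (φ := fun _ : Fin N => ℝ) i).hasFDerivAt
    (x := w)).log (hw i)).const_mul (-(1 / η))
  rw [smul_smul] at h
  simpa only [ContinuousLinearMap.proj_apply, one_div] using h

lemma fderiv_logBarrier_single (η : ℝ) {w : Fin N → ℝ} (hw : ∀ i, w i ≠ 0) (j : Fin N) :
    fderiv ℝ (logBarrier η) w (Pi.single j 1) = -(1 / η) * (1 / w j) := by
  rw [(hasFDerivAt_logBarrier η hw).fderiv]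
  simp [Pi.single_apply]

/-- The stationarity condition in coordinates; `c` is the Lagrange multiplier of the constraint that
the weights sum to one. -/
lemma IsMirrorStep.exists_inv_eq {η : ℝ} (hη : 0 < η) {g u w : Fin N → ℝ} (hu : ∀ i, 0 < u i)
    (h : IsMirrorStep η g u w) : ∃ c, ∀ i, 1 / w i = 1 / u i + η * (g i - c) := by
  rcases isEmpty_or_nonempty (Fin N) with hN | ⟨⟨j⟩⟩
  · exact ⟨0, fun i => hN.elim i⟩
  have hw : ∀ i, w i ≠ 0 := fun i => (h.1.2 i).ne'
  have hu' : ∀ i, u i ≠ 0 := fun i => (hu i).ne'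
  have hlin : HasFDerivAt (fun v : Fin N → ℝ => ∑ i, v i * g i)
      (∑ i, g i • ContinuousLinearMap.proj (R := ℝ) (φ := fun _ : Fin N => ℝ) i) w := by
    refine HasFDerivAt.fun_sum fun i _ => ?_
    exact (ContinuousLinearMap.proj (R := ℝ) (φ := fun _ : Fin N => ℝ) i).hasFDerivAt.mul_const (g i)
  have hF : HasFDerivAt (fun v => ∑ i, v i * g i + bregman (logBarrier η) v u)
      ((∑ i, g i • ContinuousLinearMap.proj (R := ℝ) (φ := fun _ : Fin N => ℝ) i) +
        (fderiv ℝ (logBarrier η) w - fderiv ℝ (logBarrier η) u)) w := by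
    refine hlin.add ?_
    have h1 := (hasFDerivAt_logBarrier η hw).differentiableAt.hasFDerivAt
    exact (h1.sub_const _).sub ((fderiv ℝ (logBarrier η) u).hasFDerivAt.comp w
      ((hasFDerivAt_id w).sub_const u))
  have key := fun i => IsArgmin.apply_single_eq h hF i j
  simp only [add_apply, sub_apply,
    fderiv_logBarrier_single η hw, fderiv_logBarrier_single η hu'] at key
  simp only [sum_apply, smul_apply,
    ContinuousLinearMap.proj_apply, Pi.single_apply, smul_eq_mul, mul_ite, mul_one, mul_zero,
    Finset.sum_ite_eq', Finset.mem_univ, if_true] at key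
  refine ⟨g j + (-(1 / η) * (1 / w j) - -(1 / η) * (1 / u j)), fun i => ?_⟩
  rw [← key i]
  generalize 1 / w i = a
  generalize 1 / u i = b
  field_simp
  ring

lemma IsArgmin.logBarrier_eq {η : ℝ} (hη : 0 < η) {w : Fin N → ℝ}
    (h : IsArgmin (logBarrier η) w) (i : Fin N) : w i = 1 / N := by
  have hw : ∀ i, w i ≠ 0 := fun i => (h.1.2 i).ne'
  have key := fun j => h.apply_single_eq (hasFDerivAt_logBarrier η hw).differentiableAt.hasFDerivAt j i
  simp only [fderiv_logBarrier_single η hw] at key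
  have heq : ∀ j, w j = w i := fun j => by
    have h1 : (1 / η) ≠ 0 := by positivity
    have h2 : 1 / w j = 1 / w i := mul_left_cancel₀ (neg_ne_zero.2 h1) (key j)
    simpa using h2
  have hsum := h.1.1.2
  simp only [heq, Finset.sum_const, Finset.card_univ, Fintype.card_fin, nsmul_eq_mul] at hsum
  have hN : (N : ℝ) ≠ 0 := by rintro h0; simp [h0] at hsum
  field_simp
  linarith

end FirstOrder

/-! ### Log-barrier divergence and the one-round inequalities -/

section Divergence

variable {N : ℕ}

/-- The Bregman divergence of the log-barrier with learning rate `1`. -/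
def barrierDiv (u v : Fin N → ℝ) : ℝ :=
  ∑ i, (u i / v i - 1 - Real.log (u i / v i))

lemma sub_one_sub_log_nonneg {r : ℝ} (hr : 0 < r) : 0 ≤ r - 1 - Real.log r := by
  linarith [Real.log_le_sub_one_of_pos hr]

lemma barrierDiv_nonneg {u v : Fin N → ℝ} (hu : ∀ i, 0 < u i) (hv : ∀ i, 0 < v i) :
    0 ≤ barrierDiv u v :=
  Finset.sum_nonneg fun i _ => sub_one_sub_log_nonneg (div_pos (hu i) (hv i))

lemma barrierDiv_self {u : Fin N → ℝ} (hu : ∀ i, 0 < u i) : barrierDiv u u = 0 :=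
  Finset.sum_eq_zero fun i _ => by simp [div_self (hu i).ne']

lemma le_barrierDiv {u v : Fin N → ℝ} (hu : ∀ i, 0 < u i) (hv : ∀ i, 0 < v i) (i : Fin N) :
    u i / v i - 1 - Real.log (u i / v i) ≤ barrierDiv u v :=
  Finset.single_le_sum (f := fun i => u i / v i - 1 - Real.log (u i / v i))
    (fun i _ => sub_one_sub_log_nonneg (div_pos (hu i) (hv i))) (Finset.mem_univ i)

/-- The linear parts `N u_i - 1` sum to zero, and each logarithm costs at most `log T` because `N
u_i ≥ 1 / T`. -/
lemma barrierDiv_uniform_le {T : ℕ} (hT : 1 ≤ T) {u v : Fin N → ℝ} (hus : ∑ i, u i = 1)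
    (hu : ∀ i, 1 / ((N : ℝ) * T) ≤ u i) (hv : ∀ i, v i = 1 / N) :
    barrierDiv u v ≤ N * Real.log T := by
  rcases Nat.eq_zero_or_pos N with rfl | hN
  · simp [barrierDiv]
  have hN' : (0 : ℝ) < N := by exact_mod_cast hN
  have hT' : (0 : ℝ) < T := by exact_mod_cast hT
  have h1 : ∀ i, u i / v i - 1 - Real.log (u i / v i) ≤ N * u i - 1 + Real.log T := fun i => by
    have h2 : u i / v i = N * u i := by rw [hv]; field_simp
    have h3 : 1 / (T : ℝ) ≤ N * u i := by
      have := mul_le_mul_of_nonneg_left (hu i) hN'.le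
      calc 1 / (T : ℝ) = N * (1 / (N * T)) := by field_simp
        _ ≤ _ := this
    have h4 := Real.log_le_log (by positivity) h3
    rw [one_div, Real.log_inv] at h4
    rw [h2]; linarith
  calc barrierDiv u v ≤ ∑ i, (N * u i - 1 + Real.log T) := Finset.sum_le_sum fun i _ => h1 i
    _ = N * Real.log T := by
      simp [Finset.sum_add_distrib, Finset.sum_sub_distrib, ← Finset.mul_sum, hus]

/-- The three-point identity of mirror descent. It is an equality because the step is characterised
by its stationarity equation; the multiplier `c` drops out since `x` and `u` have the same total
mass. -/
lemma sum_sub_mul_eq_barrierDiv {η c : ℝ} (hη : 0 < η) {g u x b : Fin N → ℝ}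
    (hu : ∀ i, 0 < u i) (hx : ∀ i, 0 < x i) (hb : ∀ i, 0 < b i) (hus : ∑ i, u i = 1)
    (hxs : ∑ i, x i = 1) (h : ∀ i, 1 / x i = 1 / b i + η * (g i - c)) :
    ∑ i, (x i - u i) * g i = (barrierDiv u b - barrierDiv u x - barrierDiv x b) / η := by
  rw [eq_div_iff hη.ne', barrierDiv, barrierDiv, barrierDiv, ← Finset.sum_sub_distrib,
    ← Finset.sum_sub_distrib]
  have h1 : ∀ i, u i / b i - 1 - Real.log (u i / b i) - (u i / x i - 1 - Real.log (u i / x i)) -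
      (x i / b i - 1 - Real.log (x i / b i)) = (x i - u i) * g i * η - (x i - u i) * (η * c) := by
    intro i
    rw [Real.log_div (hu i).ne' (hb i).ne', Real.log_div (hu i).ne' (hx i).ne',
      Real.log_div (hx i).ne' (hb i).ne']
    have h2 : η * g i = 1 / x i - 1 / b i + η * c := by linarith [h i]
    have h3 : x i / x i = 1 := div_self (hx i).ne'
    have h4 : (x i - u i) * g i * η - (x i - u i) * (η * c) = (x i - u i) * (1 / x i - 1 / b i) := by
      rw [mul_assoc, mul_comm (g i), h2]; ring
    rw [h4]
    have : (x i - u i) * (1 / x i - 1 / b i) = x i / x i - x i / b i - u i / x i + u i / b i := by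
      ring
    rw [this, h3]; ring
  simp only [h1, Finset.sum_sub_distrib, ← Finset.sum_mul, hus, hxs]
  ring

/-- The stability estimate in one coordinate: the left side is largest at `r = 1 / (1 + η δ)`, where
it equals `(η δ - log (1 + η δ)) / η`, and `log (1 + y) ≥ y - 2 y²` for `|y| ≤ 1/2`. -/
lemma mul_one_sub_sub_le {η δ r : ℝ} (hη : 0 < η) (hδ : |η * δ| ≤ 1 / 2) (hr : 0 < r) :
    δ * (1 - r) - (r - 1 - Real.log r) / η ≤ 2 * η * δ ^ 2 := by
  obtain ⟨h1, h2⟩ := abs_le.1 hδ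
  have hp : 0 < 1 + η * δ := by linarith
  have h3 := Real.log_le_sub_one_of_pos (mul_pos hr hp)
  rw [Real.log_mul hr.ne' hp.ne'] at h3
  have h4 : η * δ - 2 * (η * δ) ^ 2 ≤ Real.log (1 + η * δ) := by
    refine le_trans ?_ (Real.one_sub_inv_le_log_of_pos hp)
    rw [← one_div, le_sub_comm, div_le_iff₀ hp]
    nlinarith [mul_nonneg (sq_nonneg (η * δ)) (by linarith : 0 ≤ 1 + 2 * (η * δ))]
  have h5 : (δ * (1 - r) - (r - 1 - Real.log r) / η) * η ≤ 2 * η * δ ^ 2 * η := by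
    rw [sub_mul, div_mul_cancel₀ _ hη.ne']
    nlinarith
  exact le_of_mul_le_mul_right h5 hη

lemma optimistic_step_le {η δ c c' : ℝ} (hη : 0 < η) (hδ : |η * δ| ≤ 1 / 2)
    {m u w b b' : Fin N → ℝ} (i : Fin N)
    (hu : ∀ k, 0 < u k) (hw : ∀ k, 0 < w k) (hb : ∀ k, 0 < b k) (hb' : ∀ k, 0 < b' k)
    (hus : ∑ k, u k = 1) (hws : ∑ k, w k = 1) (hbs' : ∑ k, b' k = 1)
    (h : ∀ k, 1 / w k = 1 / b k + η * (m k - c))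
    (h' : ∀ k, 1 / b' k = 1 / b k + η * ((δ / w k * (if i = k then 1 else 0) + m k) - c')) :
    ∑ k, (w k - u k) * (δ / w k * (if i = k then 1 else 0) + m k) ≤
      barrierDiv u b / η - barrierDiv u b' / η + 2 * η * δ ^ 2 := by
  have e1 := sum_sub_mul_eq_barrierDiv hη hu hb' hb hus hbs' h'
  have e2 := sum_sub_mul_eq_barrierDiv hη hb' hw hb hbs' hws h
  have e3 : ∑ k, (w k - b' k) * (δ / w k * (if i = k then 1 else 0)) = δ * (1 - b' i / w i) := by
    have hi := (hw i).ne'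
    simp only [mul_ite, mul_one, mul_zero, Finset.sum_ite_eq, Finset.mem_univ, if_true]
    field_simp
  -- The first two sums are three-point identities for the auxiliary and the played iterate. In the
  -- last, the estimator minus the hint lives on coordinate `i` alone, so that coordinate of
  -- `barrierDiv b' w` pays for it.
  have split : ∑ k, (w k - u k) * (δ / w k * (if i = k then 1 else 0) + m k) =
      ∑ k, (b' k - u k) * (δ / w k * (if i = k then 1 else 0) + m k) +
        ∑ k, (w k - b' k) * m k + ∑ k, (w k - b' k) * (δ / w k * (if i = k then 1 else 0)) := by
    rw [← Finset.sum_add_distrib, ← Finset.sum_add_distrib]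
    exact Finset.sum_congr rfl fun k _ => by ring
  have h1 := mul_one_sub_sub_le hη hδ (div_pos (hb' i) (hw i))
  have h2 := div_le_div_of_nonneg_right (le_barrierDiv hb' hw i) hη.le
  have h3 := div_nonneg (barrierDiv_nonneg hw hb) hη.le
  rw [split, e1, e2, e3]
  simp only [sub_div]
  linarith

end Divergence

/-! ### Deviations from the hints -/

section Trajectory

variable {N T : ℕ} {η₀ : ℝ} {ℓ : ℕ → Fin N → ℝ} {I : ℕ → Fin N} {w w' : ℕ → Fin N → ℝ}
  {η : ℕ → ℝ} {s : ℕ → ℕ}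

/-- The deviation of the observed loss from the hint. -/
def deviation (ℓ : ℕ → Fin N → ℝ) (I : ℕ → Fin N) (t : ℕ) : ℝ :=
  ℓ t (I t) - hint ℓ I t (I t)

lemma lossEstimator_eq (ℓ : ℕ → Fin N → ℝ) (I : ℕ → Fin N) (w : ℕ → Fin N → ℝ) (t : ℕ)
    (i : Fin N) : lossEstimator ℓ I w t i =
      deviation ℓ I t / w t i * (if I t = i then 1 else 0) + hint ℓ I t i := by
  unfold lossEstimator deviation
  split_ifs with h
  · rw [h]
  · simp

/-- The factor `w²` cancels the importance weighting, so the doubling test measures a quantity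
bounded independently of `w`. -/
lemma sum_sq_mul_eq_deviation_sq {t : ℕ} (hw : ∀ i, 0 < w t i) :
    ∑ i, w t i ^ 2 * (lossEstimator ℓ I w t i - hint ℓ I t i) ^ 2 = deviation ℓ I t ^ 2 := by
  rw [Finset.sum_eq_single (I t)]
  · rw [lossEstimator_eq]
    have := (hw (I t)).ne'
    simp only [if_true, add_sub_cancel_right, mul_one]
    field_simp
  · intro i _ hi
    simp [lossEstimator_eq, Ne.symm hi]
  · simp

lemma lastChosen_spec {t : ℕ} {i : Fin N} (h : lastChosen I i t ≠ 0) :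
    lastChosen I i t ∈ Finset.Ico 1 t ∧ I (lastChosen I i t) = i := by
  rcases Finset.eq_empty_or_nonempty ((Finset.Ico 1 t).filter fun τ => I τ = i) with he | he
  · simp [lastChosen, he] at h
  · obtain ⟨τ, hτ, heq⟩ := Finset.exists_mem_eq_sup _ he id
    rw [lastChosen, heq]
    exact Finset.mem_filter.1 hτ

lemma hint_mem {M : ℝ} (hM : 0 ≤ M) {t : ℕ} (hℓ : ∀ τ ∈ Finset.Ico 1 t, ∀ i, ℓ τ i ∈ Set.Icc 0 M)
    (i : Fin N) : hint ℓ I t i ∈ Set.Icc 0 M := by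
  unfold hint
  split_ifs with h
  · exact ⟨le_rfl, hM⟩
  · exact hℓ _ (lastChosen_spec h).1 i

lemma le_lastChosen {t τ : ℕ} (h : τ ∈ Finset.Ico 1 t) : τ ≤ lastChosen I (I τ) t :=
  Finset.le_sup (f := id) (Finset.mem_filter.2 ⟨h, rfl⟩)

/-- Every observed loss is the hint of at most one later observation. -/
lemma sum_hint_sq_le :
    ∑ t ∈ Finset.Icc 1 T, hint ℓ I t (I t) ^ 2 ≤ ∑ t ∈ Finset.Icc 1 T, ℓ t (I t) ^ 2 := by
  have h1 : ∑ t ∈ Finset.Icc 1 T, hint ℓ I t (I t) ^ 2 =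
      ∑ t ∈ (Finset.Icc 1 T).filter (fun t => lastChosen I (I t) t ≠ 0),
        ℓ (lastChosen I (I t) t) (I (lastChosen I (I t) t)) ^ 2 := by
    rw [Finset.sum_filter]
    refine Finset.sum_congr rfl fun t _ => ?_
    by_cases h : lastChosen I (I t) t = 0
    · simp [hint, h]
    · simp [hint, h, (lastChosen_spec h).2]
  rw [h1, ← Finset.sum_image (s := (Finset.Icc 1 T).filter (fun t => lastChosen I (I t) t ≠ 0))
    (g := fun t => lastChosen I (I t) t) (f := fun τ => ℓ τ (I τ) ^ 2)]
  · refine Finset.sum_le_sum_of_subset_of_nonneg ?_ fun _ _ _ => sq_nonneg _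
    intro τ hτ
    obtain ⟨t, ht, rfl⟩ := Finset.mem_image.1 hτ
    obtain ⟨ht1, ht2⟩ := Finset.mem_filter.1 ht
    have h2 := Finset.mem_Ico.1 (lastChosen_spec ht2).1
    have h3 := Finset.mem_Icc.1 ht1
    exact Finset.mem_Icc.2 ⟨h2.1, by omega⟩
  -- If rounds `a < b` shared a hint round, both would choose the same index; then `a` itself would
  -- be a more recent choice of it before `b`.
  · have key : ∀ a b, 1 ≤ a → a < b → lastChosen I (I b) b ≠ 0 →
        lastChosen I (I a) a ≠ 0 → lastChosen I (I a) a ≠ lastChosen I (I b) b := by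
      intro a b ha hab hb0 ha0 heq
      have h2 := lastChosen_spec ha0
      have h3 := lastChosen_spec hb0
      have h4 : I a = I b := by rw [← h2.2, heq, h3.2]
      have h5 := le_lastChosen (I := I) (Finset.mem_Ico.2 ⟨ha, hab⟩)
      have h6 := Finset.mem_Ico.1 h2.1
      rw [h4, ← heq] at h5
      omega
    intro a ha b hb heq
    obtain ⟨ha1, ha2⟩ := Finset.mem_filter.1 ha
    obtain ⟨hb1, hb2⟩ := Finset.mem_filter.1 hb
    rcases lt_trichotomy a b with h | h | h
    · exact absurd heq (key a b (Finset.mem_Icc.1 ha1).1 h hb2 ha2)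
    · exact h
    · exact absurd heq.symm (key b a (Finset.mem_Icc.1 hb1).1 h ha2 hb2)

/-- For nonnegative numbers `(a - b)² ≤ a² + b²`. The squared hints are charged to distinct earlier
losses, and `2 ℓ² ≤ ℓ` for losses in `[0, 1/2]`. -/
lemma sum_deviation_sq_le (hℓ : ∀ t ∈ Finset.Icc 1 T, ∀ i, ℓ t i ∈ Set.Icc (0 : ℝ) (1 / 2)) :
    ∑ t ∈ Finset.Icc 1 T, deviation ℓ I t ^ 2 ≤ ∑ t ∈ Finset.Icc 1 T, ℓ t (I t) := by
  have h1 : ∀ t ∈ Finset.Icc 1 T, deviation ℓ I t ^ 2 ≤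
      ℓ t (I t) ^ 2 + hint ℓ I t (I t) ^ 2 := by
    intro t ht
    have h2 := (hint_mem (I := I) (t := t) (by norm_num : (0 : ℝ) ≤ 1 / 2) (fun τ hτ i => hℓ τ
      (by simp only [Finset.mem_Ico, Finset.mem_Icc] at *; omega) i) (I t)).1
    have h3 := (hℓ t ht (I t)).1
    unfold deviation
    nlinarith [mul_nonneg h2 h3]
  have h4 : ∀ t ∈ Finset.Icc 1 T, ℓ t (I t) ^ 2 ≤ ℓ t (I t) / 2 := by
    intro t ht
    obtain ⟨h5, h6⟩ := hℓ t ht (I t)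
    nlinarith
  calc _ ≤ ∑ t ∈ Finset.Icc 1 T, (ℓ t (I t) ^ 2 + hint ℓ I t (I t) ^ 2) := Finset.sum_le_sum h1
    _ ≤ ∑ t ∈ Finset.Icc 1 T, ℓ t (I t) ^ 2 + ∑ t ∈ Finset.Icc 1 T, ℓ t (I t) ^ 2 := by
      rw [Finset.sum_add_distrib]
      linarith [sum_hint_sq_le (ℓ := ℓ) (I := I) (T := T)]
    _ ≤ ∑ t ∈ Finset.Icc 1 T, ℓ t (I t) / 2 + ∑ t ∈ Finset.Icc 1 T, ℓ t (I t) / 2 :=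
      add_le_add (Finset.sum_le_sum h4) (Finset.sum_le_sum h4)
    _ = _ := by rw [← Finset.sum_div]; ring

end Trajectory

/-! ### Pathwise regret under the doubling trick -/

section Regret

variable {N T : ℕ} {η₀ : ℝ} {ℓ : ℕ → Fin N → ℝ} {I : ℕ → Fin N} {w w' : ℕ → Fin N → ℝ}
  {η : ℕ → ℝ} {s : ℕ → ℕ}

/-- For the last round of an epoch, which is followed by a restart and not by an auxiliary mirror
step. Here `u` takes the place of the next auxiliary iterate in the stability term. -/
lemma optimistic_last_step_le {η δ c : ℝ} (hη : 0 < η) (hδ : |η * δ| ≤ 1 / 2)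
    {m u w b : Fin N → ℝ} (i : Fin N)
    (hu : ∀ k, 0 < u k) (hw : ∀ k, 0 < w k) (hb : ∀ k, 0 < b k)
    (hus : ∑ k, u k = 1) (hws : ∑ k, w k = 1)
    (h : ∀ k, 1 / w k = 1 / b k + η * (m k - c)) :
    ∑ k, (w k - u k) * (δ / w k * (if i = k then 1 else 0) + m k) ≤
      barrierDiv u b / η + 2 * η * δ ^ 2 := by
  have e2 := sum_sub_mul_eq_barrierDiv hη hu hw hb hus hws h
  have e3 : ∑ k, (w k - u k) * (δ / w k * (if i = k then 1 else 0)) = δ * (1 - u i / w i) := by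
    have hi := (hw i).ne'
    simp only [mul_ite, mul_one, mul_zero, Finset.sum_ite_eq, Finset.mem_univ, if_true]
    field_simp
  have h1 := mul_one_sub_sub_le hη hδ (div_pos (hu i) (hw i))
  have h2 := div_le_div_of_nonneg_right (le_barrierDiv hu hw i) hη.le
  have h3 := div_nonneg (barrierDiv_nonneg hw hb) hη.le
  simp only [mul_add, Finset.sum_add_distrib]
  rw [e2, e3]
  simp only [sub_div]
  linarith

/-- The estimated regret of round `t` against `u`. -/
def estimatedRegret (ℓ : ℕ → Fin N → ℝ) (I : ℕ → Fin N) (w : ℕ → Fin N → ℝ) (u : Fin N → ℝ)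
    (t : ℕ) : ℝ :=
  ∑ i, (w t i - u i) * lossEstimator ℓ I w t i

lemma IsOptimisticOMD.state (H : IsOptimisticOMD η₀ T ℓ I w w' η s) (h0 : 0 < η₀) {t : ℕ}
    (h1 : 1 ≤ t) : t ≤ T + 1 →
      w' t ∈ positiveSimplex N ∧ 0 < η t ∧ η t ≤ η₀ ∧ 1 ≤ s t ∧ s t ≤ t := by
  induction t, h1 using Nat.le_induction with
  | base =>
    intro _
    exact ⟨H.aux_one.1, by rw [H.rate_one]; exact h0, H.rate_one.le, H.epoch_one.ge, H.epoch_one.le⟩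
  | succ t h1 ih =>
    intro h2
    obtain ⟨_, b, c, d, e⟩ := ih (by omega)
    have ht : t ∈ Finset.Icc 1 T := Finset.mem_Icc.2 ⟨h1, by omega⟩
    by_cases hE : EpochOver T (η t) (s t) ℓ I w t
    · obtain ⟨p, q, r⟩ := H.restart t ht hE
      rw [p, q]
      exact ⟨r.1, by linarith, by linarith, by omega, le_rfl⟩
    · obtain ⟨p, q, r⟩ := H.continuation t ht hE
      rw [p, q]
      exact ⟨r.1, b, c, d, by omega⟩

lemma deviation_mem {t : ℕ} {M : ℝ} (hM : 0 ≤ M)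
    (hℓ : ∀ τ ∈ Finset.Icc 1 t, ∀ i, ℓ τ i ∈ Set.Icc 0 M) (h1 : 1 ≤ t) :
    |deviation ℓ I t| ≤ M := by
  have h2 := hint_mem (I := I) (t := t) hM (fun τ hτ i => hℓ τ
    (by simp only [Finset.mem_Ico, Finset.mem_Icc] at *; omega) i) (I t)
  have h3 := hℓ t (Finset.mem_Icc.2 ⟨h1, le_rfl⟩) (I t)
  rw [deviation, abs_le]
  constructor <;> linarith [h2.1, h2.2, h3.1, h3.2]

lemma abs_mul_le_half {a b : ℝ} (ha : 0 < a) (ha1 : a ≤ 1) (hb : |b| ≤ 1 / 2) :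
    |a * b| ≤ 1 / 2 := by
  rw [abs_mul, abs_of_pos ha]
  nlinarith [abs_nonneg b]

lemma IsOptimisticOMD.action_inv (H : IsOptimisticOMD η₀ T ℓ I w w' η s) (h0 : 0 < η₀) {t : ℕ}
    (ht : t ∈ Finset.Icc 1 T) :
    w t ∈ positiveSimplex N ∧ ∃ c, ∀ i, 1 / w t i = 1 / w' t i + η t * (hint ℓ I t i - c) := by
  obtain ⟨h1, h2⟩ := Finset.mem_Icc.1 ht
  obtain ⟨a, b, -⟩ := H.state h0 h1 (by omega)
  exact ⟨(H.action t ht).1, (H.action t ht).exists_inv_eq b a.2⟩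

lemma IsOptimisticOMD.restart_le (H : IsOptimisticOMD η₀ T ℓ I w w' η s) (h0 : 0 < η₀)
    (h01 : η₀ ≤ 1) (hℓ : ∀ t ∈ Finset.Icc 1 T, ∀ i, ℓ t i ∈ Set.Icc (0 : ℝ) (1 / 2)) {t : ℕ}
    (ht : t ∈ Finset.Icc 1 T) {u : Fin N → ℝ} (hu : u ∈ positiveSimplex N) :
    estimatedRegret ℓ I w u t ≤
      barrierDiv u (w' t) / η t + 2 * η t * deviation ℓ I t ^ 2 := by
  obtain ⟨h1, h2⟩ := Finset.mem_Icc.1 ht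
  obtain ⟨a, b, c, -⟩ := H.state h0 h1 (by omega)
  obtain ⟨p, k, q⟩ := H.action_inv h0 ht
  have hd : |deviation ℓ I t| ≤ 1 / 2 := deviation_mem (by norm_num) (fun τ hτ => hℓ τ
    (by simp only [Finset.mem_Icc] at *; omega)) h1
  have := optimistic_last_step_le b (abs_mul_le_half b (c.trans h01) hd) (I t) hu.2 p.2 a.2
    hu.1.2 p.1.2 q
  simpa only [estimatedRegret, lossEstimator_eq] using this

lemma IsOptimisticOMD.continuation_le (H : IsOptimisticOMD η₀ T ℓ I w w' η s) (h0 : 0 < η₀)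
    (h01 : η₀ ≤ 1) (hℓ : ∀ t ∈ Finset.Icc 1 T, ∀ i, ℓ t i ∈ Set.Icc (0 : ℝ) (1 / 2)) {t : ℕ}
    (ht : t ∈ Finset.Icc 1 T) (hE : ¬ EpochOver T (η t) (s t) ℓ I w t)
    {u : Fin N → ℝ} (hu : u ∈ positiveSimplex N) :
    estimatedRegret ℓ I w u t + barrierDiv u (w' (t + 1)) / η (t + 1) ≤
      barrierDiv u (w' t) / η t + 2 * η t * deviation ℓ I t ^ 2 := by
  obtain ⟨h1, h2⟩ := Finset.mem_Icc.1 ht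
  obtain ⟨a, b, c, -⟩ := H.state h0 h1 (by omega)
  obtain ⟨p, k, q⟩ := H.action_inv h0 ht
  obtain ⟨e, -, r⟩ := H.continuation t ht hE
  obtain ⟨k', q'⟩ := r.exists_inv_eq b a.2
  have hd : |deviation ℓ I t| ≤ 1 / 2 := deviation_mem (by norm_num) (fun τ hτ => hℓ τ
    (by simp only [Finset.mem_Icc] at *; omega)) h1
  simp only [lossEstimator_eq] at q'
  have := optimistic_step_le b (abs_mul_le_half b (c.trans h01) hd) (I t) hu.2 p.2 a.2 r.1.2
    hu.1.2 p.1.2 r.1.1.2 q q'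
  rw [e]
  simp only [estimatedRegret, lossEstimator_eq]
  linarith

/-- Against the uniform distribution every restart is free. -/
theorem IsOptimisticOMD.sum_estimatedRegret_uniform_le (H : IsOptimisticOMD η₀ T ℓ I w w' η s)
    (h0 : 0 < η₀) (h01 : η₀ ≤ 1)
    (hℓ : ∀ t ∈ Finset.Icc 1 T, ∀ i, ℓ t i ∈ Set.Icc (0 : ℝ) (1 / 2)) :
    ∑ t ∈ Finset.Icc 1 T, estimatedRegret ℓ I w (fun _ => 1 / N) t ≤
      2 * η₀ * ∑ t ∈ Finset.Icc 1 T, deviation ℓ I t ^ 2 := by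
  set u : Fin N → ℝ := fun _ => 1 / N with hudef
  have hstart : ∀ {r} {v : Fin N → ℝ}, 0 < r → IsArgmin (logBarrier r) v → v = u := fun hr hv =>
    funext fun i => hv.logBarrier_eq hr i
  have h1 : w' 1 = u := hstart (by rw [H.rate_one]; exact h0) H.aux_one
  have hu : u ∈ positiveSimplex N := h1 ▸ H.aux_one.1
  have key : ∀ t, t ≤ T → ∑ τ ∈ Finset.Icc 1 t, estimatedRegret ℓ I w u τ +
      barrierDiv u (w' (t + 1)) / η (t + 1) ≤
        2 * η₀ * ∑ τ ∈ Finset.Icc 1 t, deviation ℓ I τ ^ 2 := by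
    intro t
    induction t with
    | zero =>
      intro _
      simp [h1, barrierDiv_self hu.2]
    | succ t ih =>
      intro ht
      have ih := ih (by omega)
      have hm : t + 1 ∈ Finset.Icc 1 T := Finset.mem_Icc.2 ⟨by omega, ht⟩
      obtain ⟨a, b, c, -⟩ := H.state h0 (by omega : 1 ≤ t + 1) (by omega)
      rw [Finset.sum_Icc_succ_top (by omega), Finset.sum_Icc_succ_top (by omega)]
      have h4 : 2 * η (t + 1) * deviation ℓ I (t + 1) ^ 2 ≤
          2 * η₀ * deviation ℓ I (t + 1) ^ 2 := by gcongr
      by_cases hE : EpochOver T (η (t + 1)) (s (t + 1)) ℓ I w (t + 1)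
      · obtain ⟨p, -, r⟩ := H.restart _ hm hE
        have h2 := H.restart_le h0 h01 hℓ hm hu
        have h3 : w' (t + 1 + 1) = u := hstart (by rw [p]; positivity) r
        rw [h3, barrierDiv_self hu.2, zero_div]
        linarith
      · have h2 := H.continuation_le h0 h01 hℓ hm hE hu
        linarith
  have h5 := key T le_rfl
  obtain ⟨a, b, -⟩ := H.state h0 (by omega : 1 ≤ T + 1) le_rfl
  have := div_nonneg (barrierDiv_nonneg hu.2 a.2) b.le
  linarith

lemma IsOptimisticOMD.epochOver_iff (H : IsOptimisticOMD η₀ T ℓ I w w' η s) (h0 : 0 < η₀) {t : ℕ}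
    (ht : t ∈ Finset.Icc 1 T) : EpochOver T (η t) (s t) ℓ I w t ↔
      (N : ℝ) * Real.log T / (3 * η t ^ 2) ≤ ∑ τ ∈ Finset.Icc (s t) t, deviation ℓ I τ ^ 2 := by
  obtain ⟨h1, h2⟩ := Finset.mem_Icc.1 ht
  obtain ⟨-, -, -, d, e⟩ := H.state h0 h1 (by omega)
  rw [EpochOver]
  have : ∀ τ ∈ Finset.Icc (s t) t, ∑ i, w τ i ^ 2 *
      (lossEstimator ℓ I w τ i - hint ℓ I τ i) ^ 2 = deviation ℓ I τ ^ 2 := fun τ hτ =>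
    sum_sq_mul_eq_deviation_sq (H.action_inv h0 (by simp only [Finset.mem_Icc] at *; omega)).1.2
  rw [Finset.sum_congr rfl this]

/-- The regret bound of the doubling trick against distributions bounded away from the boundary. -/
theorem IsOptimisticOMD.sum_estimatedRegret_le (H : IsOptimisticOMD η₀ T ℓ I w w' η s)
    (h0 : 0 < η₀) (h01 : η₀ ≤ 1) (hT : 1 ≤ T)
    (hℓ : ∀ t ∈ Finset.Icc 1 T, ∀ i, ℓ t i ∈ Set.Icc (0 : ℝ) (1 / 2))
    {u : Fin N → ℝ} (hu : u ∈ positiveSimplex N) (hub : ∀ i, 1 / ((N : ℝ) * T) ≤ u i)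
    {κ : ℝ} (hκ : 0 < κ) :
    ∑ t ∈ Finset.Icc 1 T, estimatedRegret ℓ I w u t ≤
      10 / 3 * (N * Real.log T / η₀ + κ * (N * Real.log T) +
        3 / κ * ∑ t ∈ Finset.Icc 1 T, deviation ℓ I t ^ 2) + 1 := by
  set K : ℝ := N * Real.log T with hK
  have hK0 : 0 ≤ K := mul_nonneg (Nat.cast_nonneg _) (Real.log_natCast_nonneg _)
  have hstart : ∀ {r} {v : Fin N → ℝ}, 0 < r → IsArgmin (logBarrier r) v → barrierDiv u v ≤ K :=
    fun hr hv => barrierDiv_uniform_le hT hu.1.2 hub fun i => hv.logBarrier_eq hr i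
  have hη1 : 0 < η 1 := by rw [H.rate_one]; exact h0
  -- Three invariants: a potential bound, a cap on the deviation of the current epoch, and a lower
  -- bound on the total deviation once the rate has been halved. The coefficient `8/3` solves `a +
  -- 2/3 + 2 = 2 a`: at a restart `2/3` pays for the finished epoch, `2` for the new initial
  -- divergence, and `K / η` doubles. The round that triggers the restart costs at most `η / 2`,
  -- which is the drop of the rate and telescopes in `η₀ - η`.
  have key : ∀ t, t ≤ T →
      (∑ τ ∈ Finset.Icc 1 t, estimatedRegret ℓ I w u τ +
        barrierDiv u (w' (t + 1)) / η (t + 1) ≤ 8 / 3 * K / η (t + 1) +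
          2 * η (t + 1) * ∑ τ ∈ Finset.Icc (s (t + 1)) t, deviation ℓ I τ ^ 2 +
            (η₀ - η (t + 1))) ∧
      (∑ τ ∈ Finset.Icc (s (t + 1)) t, deviation ℓ I τ ^ 2 ≤ K / (3 * η (t + 1) ^ 2)) ∧
      (η (t + 1) = η₀ ∨ K / (12 * η (t + 1) ^ 2) ≤ ∑ τ ∈ Finset.Icc 1 t, deviation ℓ I τ ^ 2) := by
    intro t
    induction t with
    | zero =>
      intro _
      have h2 : Finset.Icc (s 1) 0 = ∅ := by rw [H.epoch_one]; rfl
      have h3 := div_le_div_of_nonneg_right (hstart hη1 H.aux_one) hη1.le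
      have h4 : 0 ≤ K / η 1 := by positivity
      refine ⟨?_, ?_, Or.inl H.rate_one⟩
      · simp only [zero_add, h2, Finset.sum_empty, H.rate_one, mul_zero, mul_div_assoc] at *
        simp
        linarith
      · simp only [zero_add, h2, Finset.sum_empty]
        positivity
    | succ t ih =>
      intro ht
      obtain ⟨ih1, ih2, ih3⟩ := ih (by omega)
      have hm : t + 1 ∈ Finset.Icc 1 T := Finset.mem_Icc.2 ⟨by omega, ht⟩
      obtain ⟨a, b, c, d, e⟩ := H.state h0 (by omega : 1 ≤ t + 1) (by omega)
      have hE' := H.epochOver_iff h0 hm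
      rw [Finset.sum_Icc_succ_top e] at hE'
      have hone : 1 ≤ t + 1 := by omega
      rw [Finset.sum_Icc_succ_top hone, Finset.sum_Icc_succ_top hone]
      have hdev : |deviation ℓ I (t + 1)| ≤ 1 / 2 := deviation_mem (by norm_num) (fun τ hτ => hℓ τ
        (by simp only [Finset.mem_Icc] at *; omega)) (by omega)
      have hdev2 : deviation ℓ I (t + 1) ^ 2 ≤ 1 / 4 := by
        rw [← sq_abs]; nlinarith [abs_nonneg (deviation ℓ I (t + 1))]
      have hdev0 := sq_nonneg (deviation ℓ I (t + 1))
      by_cases hE : EpochOver T (η (t + 1)) (s (t + 1)) ℓ I w (t + 1)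
      · obtain ⟨p, q, r⟩ := H.restart _ hm hE
        have h2 := H.restart_le h0 h01 hℓ hm hu
        have h3 := hstart (by rw [p]; positivity) r
        have h4 : Finset.Icc (s (t + 1 + 1)) (t + 1) = ∅ := by
          rw [q]; exact Finset.Icc_eq_empty (by omega)
        have h5 : ∑ τ ∈ Finset.Icc (s (t + 1)) t, deviation ℓ I τ ^ 2 ≤
            ∑ τ ∈ Finset.Icc 1 t, deviation ℓ I τ ^ 2 :=
          Finset.sum_le_sum_of_subset_of_nonneg (Finset.Icc_subset_Icc_left d)
            fun _ _ _ => sq_nonneg _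
        rw [h4, Finset.sum_empty, p]
        refine ⟨?_, by positivity, Or.inr ?_⟩
        · have h6 : barrierDiv u (w' (t + 1 + 1)) / (η (t + 1) / 2) ≤ 2 * (K / η (t + 1)) := by
            rw [div_div_eq_mul_div, ← mul_div_assoc, mul_comm]
            gcongr
          have h7 : 2 * η (t + 1) * ∑ τ ∈ Finset.Icc (s (t + 1)) t, deviation ℓ I τ ^ 2 ≤
              2 / 3 * (K / η (t + 1)) := by
            calc _ ≤ 2 * η (t + 1) * (K / (3 * η (t + 1) ^ 2)) := by gcongr
              _ = _ := by field_simp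
          have h8 : 8 / 3 * K / (η (t + 1) / 2) = 16 / 3 * (K / η (t + 1)) := by
            ring
          have h9 : 8 / 3 * K / η (t + 1) = 8 / 3 * (K / η (t + 1)) := by ring
          have h10 : 2 * η (t + 1) * deviation ℓ I (t + 1) ^ 2 ≤ 2 * η (t + 1) * (1 / 4) := by
            gcongr
          rw [h8]
          rw [h9] at ih1
          linarith
        · have h6 := hE'.1 hE
          have h7 : K / (12 * (η (t + 1) / 2) ^ 2) = K / (3 * η (t + 1) ^ 2) := by
            congr 1; ring
          rw [h7]
          linarith
      · obtain ⟨p, q, -⟩ := H.continuation _ hm hE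
        have h2 := H.continuation_le h0 h01 hℓ hm hE hu
        rw [p, q, Finset.sum_Icc_succ_top e]
        rw [p] at h2
        refine ⟨by linarith, ?_, ?_⟩
        · exact (not_le.1 fun h => hE (hE'.2 h)).le
        · rcases ih3 with h | h
          · exact Or.inl h
          · exact Or.inr (by linarith)
  obtain ⟨k1, k2, k3⟩ := key T le_rfl
  obtain ⟨a, b, c, -⟩ := H.state h0 (by omega : 1 ≤ T + 1) le_rfl
  have hD := div_nonneg (barrierDiv_nonneg hu.2 a.2) b.le
  set Dv := ∑ t ∈ Finset.Icc 1 T, deviation ℓ I t ^ 2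
  have hDv : 0 ≤ Dv := Finset.sum_nonneg fun _ _ => sq_nonneg _
  have h7 : 2 * η (T + 1) * ∑ τ ∈ Finset.Icc (s (T + 1)) T, deviation ℓ I τ ^ 2 ≤
      2 / 3 * (K / η (T + 1)) := by
    calc _ ≤ 2 * η (T + 1) * (K / (3 * η (T + 1) ^ 2)) := by gcongr
      _ = _ := by field_simp
  have h9 : 8 / 3 * K / η (T + 1) = 8 / 3 * (K / η (T + 1)) := by ring
  -- If the rate was ever halved, `K / (12 η²) ≤ Dv`, and the inequality of arithmetic and geometric
  -- means, in the form of the square `(κ - 1 / (2 η))²`, bounds `K / η`.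
  have h8 : K / η (T + 1) ≤ K / η₀ + κ * K + 3 / κ * Dv := by
    rcases k3 with h | h
    · rw [h]
      have : 0 ≤ κ * K := by positivity
      have : 0 ≤ 3 / κ * Dv := by positivity
      linarith
    · have h10 : 3 / κ * (K / (12 * η (T + 1) ^ 2)) ≤ 3 / κ * Dv := by gcongr
      have h11 : 0 ≤ K / η₀ := by positivity
      have h12 : κ * K + 3 / κ * (K / (12 * η (T + 1) ^ 2)) - K / η (T + 1) =
          K / κ * (κ - 1 / (2 * η (T + 1))) ^ 2 := by
        field_simp; ring
      have h13 : 0 ≤ K / κ * (κ - 1 / (2 * η (T + 1))) ^ 2 := by positivity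
      linarith
  rw [h9] at k1
  linarith

end Regret

/-! ### Pathwise lower bounds on the sampling probabilities -/

section LowerBound

variable {N T : ℕ} {η₀ : ℝ} {ℓ : ℕ → Fin N → ℝ} {I : ℕ → Fin N} {w w' : ℕ → Fin N → ℝ}
  {η : ℕ → ℝ} {s : ℕ → ℕ}

/-- Equal total mass forces some coordinate `j` not to decrease, so the multiplier satisfies `c ≥ g
j ≥ g i - R`. -/
lemma inv_le_of_mirror {η c R : ℝ} (hη : 0 < η) {g x b : Fin N → ℝ}
    (hb : ∀ i, 0 < b i) (hxs : ∑ i, x i = 1) (hbs : ∑ i, b i = 1)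
    (h : ∀ i, 1 / x i = 1 / b i + η * (g i - c)) (hg : ∀ i j, g i - g j ≤ R) (i : Fin N) :
    1 / x i ≤ 1 / b i + η * R := by
  obtain ⟨j, -, hj⟩ : ∃ j ∈ Finset.univ, b j ≤ x j :=
    Finset.exists_le_of_sum_le ⟨i, Finset.mem_univ i⟩ (by rw [hxs, hbs])
  have h1 : 1 / x j ≤ 1 / b j := one_div_le_one_div_of_le (hb j) hj
  have h2 : η * (g j - c) ≤ 0 := by linarith [h j]
  have h3 : η * (g i - c) ≤ η * R + η * (g j - c) := by
    rw [← mul_add]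
    exact mul_le_mul_of_nonneg_left (by linarith [hg i j]) hη.le
  linarith [h i]

/-- The iterates are bounded away from the boundary of the simplex. -/
theorem IsOptimisticOMD.one_div_le (H : IsOptimisticOMD η₀ T ℓ I w w' η s) (h0 : 0 < η₀)
    (h01 : η₀ ≤ 1) (hℓ : ∀ t ∈ Finset.Icc 1 T, ∀ i, ℓ t i ∈ Set.Icc (0 : ℝ) (1 / 2)) {t : ℕ}
    (ht : t ∈ Finset.Icc 1 T) (i : Fin N) : 1 / w t i ≤ 5 ^ t * N := by
  have hN : (1 : ℝ) ≤ N := by exact_mod_cast i.pos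
  have hact : ∀ t, t + 1 ∈ Finset.Icc 1 T → (∀ i, 1 / w' (t + 1) i ≤ 5 ^ t * N) →
      ∀ i, 1 / w (t + 1) i ≤ 2 * (5 ^ t * N) := by
    intro t ht ih i
    obtain ⟨a, b, e, -⟩ := H.state h0 (by omega : 1 ≤ t + 1)
      (by have := (Finset.mem_Icc.1 ht).2; omega)
    obtain ⟨p, k, q⟩ := H.action_inv h0 ht
    have hh := fun i => hint_mem (ℓ := ℓ) (I := I) (t := t + 1) (by norm_num : (0 : ℝ) ≤ 1 / 2)
      (fun τ hτ i => hℓ τ (by simp only [Finset.mem_Ico, Finset.mem_Icc] at *; omega) i) i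
    have h1 := inv_le_of_mirror b a.2 p.1.2 a.1.2 q (R := 1)
      (fun i j => by linarith [(hh i).1, (hh i).2, (hh j).1, (hh j).2]) i
    have h2 : (1 : ℝ) ≤ 5 ^ t := one_le_pow₀ (by norm_num)
    nlinarith [ih i]
  -- The estimator is at most `3/2 * 5 ^ t * N` in absolute value, so one auxiliary step adds at
  -- most `3 * 5 ^ t * N`; a growth factor of `4` would suffice. The crude bound serves only
  -- integrability.
  have key : ∀ t, t < T → ∀ i, 1 / w' (t + 1) i ≤ 5 ^ t * N := by
    intro t
    induction t with
    | zero =>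
      intro _ i
      rw [H.aux_one.logBarrier_eq (by rw [H.rate_one]; exact h0) i]
      simp
    | succ t ih =>
      intro ht i
      have ih := ih (by omega)
      have hm : t + 1 ∈ Finset.Icc 1 T := Finset.mem_Icc.2 ⟨by omega, by omega⟩
      have hw := hact t hm ih
      obtain ⟨a, b, e, -⟩ := H.state h0 (by omega : 1 ≤ t + 1) (by omega)
      have h2 : (1 : ℝ) ≤ 5 ^ t := one_le_pow₀ (by norm_num)
      have h3 : (1 : ℝ) ≤ 5 ^ t * N := by nlinarith
      by_cases hE : EpochOver T (η (t + 1)) (s (t + 1)) ℓ I w (t + 1)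
      · obtain ⟨p, -, r⟩ := H.restart _ hm hE
        rw [r.logBarrier_eq (by rw [p]; positivity) i, one_div_one_div, pow_succ]
        nlinarith
      · obtain ⟨-, -, r⟩ := H.continuation _ hm hE
        obtain ⟨k, q⟩ := r.exists_inv_eq b a.2
        have hwp := (H.action_inv h0 hm).1.2
        have hh := fun i => hint_mem (ℓ := ℓ) (I := I) (t := t + 1) (by norm_num : (0 : ℝ) ≤ 1 / 2)
          (fun τ hτ i => hℓ τ (by simp only [Finset.mem_Ico, Finset.mem_Icc] at *; omega) i) i
        have hd : |deviation ℓ I (t + 1)| ≤ 1 / 2 := deviation_mem (by norm_num) (fun τ hτ => hℓ τ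
          (by simp only [Finset.mem_Icc] at *; omega)) (by omega)
        have hg : ∀ i, |lossEstimator ℓ I w (t + 1) i| ≤ 3 / 2 * (5 ^ t * N) := by
          intro i
          rw [lossEstimator_eq]
          have h5 : |deviation ℓ I (t + 1) / w (t + 1) i * (if I (t + 1) = i then 1 else 0)| ≤
              5 ^ t * N := by
            have h6 : |deviation ℓ I (t + 1) / w (t + 1) i| ≤ 5 ^ t * N := by
              rw [div_eq_mul_one_div, abs_mul, abs_of_pos (one_div_pos.2 (hwp i))]
              have := one_div_pos.2 (hwp i)
              nlinarith [hw i, abs_nonneg (deviation ℓ I (t + 1))]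
            split_ifs
            · rwa [mul_one]
            · rw [mul_zero, abs_zero]; positivity
          have h7 : |hint ℓ I (t + 1) i| ≤ 1 / 2 := abs_le.2 ⟨by linarith [(hh i).1], (hh i).2⟩
          linarith [abs_add_le (deviation ℓ I (t + 1) / w (t + 1) i *
            (if I (t + 1) = i then 1 else 0)) (hint ℓ I (t + 1) i)]
        have h1 := inv_le_of_mirror b a.2 r.1.1.2 a.1.2 q (R := 3 * (5 ^ t * N))
          (fun i j => by linarith [(abs_le.1 (hg i)).2, (abs_le.1 (hg j)).1]) i
        have h8 : η (t + 1) * (3 * (5 ^ t * N)) ≤ 1 * (3 * (5 ^ t * N)) := by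
          gcongr; exact e.trans h01
        rw [pow_succ]
        linarith [ih i]
  obtain ⟨h1, h2⟩ := Finset.mem_Icc.1 ht
  obtain ⟨t, rfl⟩ : ∃ r, t = r + 1 := ⟨t - 1, by omega⟩
  have := hact t ht (key t (by omega)) i
  rw [pow_succ]
  nlinarith [pow_pos (by norm_num : (0 : ℝ) < 5) t]

end LowerBound

/-! ### Gaussian tails and half-spaces -/

section GaussianTail

lemma gaussianQ_eq (x : ℝ) : gaussianQ x = (gaussianReal 0 1).real (Set.Ioi x) := by
  rw [measureReal_def, gaussianReal_apply_eq_integral _ one_ne_zero, ENNReal.toReal_ofReal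
    (setIntegral_nonneg measurableSet_Ioi fun _ _ => gaussianPDFReal_nonneg _ _ _)]
  simp [gaussianQ, gaussianPDFReal]

lemma gaussianQ_nonneg (x : ℝ) : 0 ≤ gaussianQ x := by
  rw [gaussianQ_eq]; exact measureReal_nonneg

lemma gaussianQ_le_half {x : ℝ} (hx : 0 ≤ x) : gaussianQ x ≤ 1 / 2 := by
  have h1 : (gaussianReal 0 1).real (Set.Ioi x) = (gaussianReal 0 1).real (Set.Iio (-x)) := by
    conv_lhs => rw [← neg_zero, ← gaussianReal_map_neg]
    rw [map_measureReal_apply measurable_neg measurableSet_Ioi]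
    congr 1
    ext y
    simp
  have h2 : (gaussianReal 0 1).real (Set.Ioi x) + (gaussianReal 0 1).real (Set.Iio (-x)) ≤ 1 := by
    rw [← measureReal_union _ measurableSet_Iio]
    · exact measureReal_le_one
    · refine Set.disjoint_left.2 fun y hy hy' => ?_
      simp only [Set.mem_Ioi, Set.mem_Iio] at hy hy'
      linarith
  rw [gaussianQ_eq]
  linarith

lemma gaussianQ_le_sqrt {x : ℝ} (hx : 0 ≤ x) :
    gaussianQ x ≤ Real.sqrt (gaussianQ x * (1 - gaussianQ x)) := by
  have h1 := gaussianQ_nonneg x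
  have h2 := gaussianQ_le_half hx
  exact Real.le_sqrt_of_sq_le (by nlinarith)

variable {d : ℕ}

lemma posSemidef_smul_one (σ : ℝ) :
    (σ ^ 2 • (1 : Matrix (Fin d) (Fin d) ℝ)).PosSemidef :=
  Matrix.PosSemidef.one.smul (sq_nonneg σ)

lemma map_inner_isotropic_gaussian (σ : ℝ) (v : Signal d) :
    (multivariateGaussian 0 (σ ^ 2 • (1 : Matrix (Fin d) (Fin d) ℝ))).map (fun z => inner ℝ v z) =
      gaussianReal 0 ((σ * ‖v‖) ^ 2).toNNReal := by
  have h := IsGaussian.map_eq_gaussianReal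
    (μ := multivariateGaussian 0 (σ ^ 2 • (1 : Matrix (Fin d) (Fin d) ℝ))) (innerSL ℝ v)
  have h1 : ∫ z, innerSL ℝ v z ∂(multivariateGaussian 0 (σ ^ 2 • (1 : Matrix (Fin d) (Fin d) ℝ)))
      = 0 := by
    rw [(innerSL ℝ v).integral_comp_id_comm IsGaussian.integrable_id]
    simp
  have h2 : Var[innerSL ℝ v; multivariateGaussian 0 (σ ^ 2 • (1 : Matrix (Fin d) (Fin d) ℝ))] =
      (σ * ‖v‖) ^ 2 := by
    have h3 := covarianceBilin_multivariateGaussian (μ := 0) (posSemidef_smul_one (d := d) σ) v v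
    rw [covarianceBilin_apply_eq_cov IsGaussian.memLp_two_id,
      covariance_self (by fun_prop)] at h3
    have h4 : (innerSL ℝ v : Signal d → ℝ) = fun u => inner ℝ v u := rfl
    rw [h4, h3, Matrix.smul_mulVec, Matrix.one_mulVec, dotProduct_smul, mul_pow,
      EuclideanSpace.real_norm_sq_eq]
    simp [dotProduct, sq]
  rw [h1, h2] at h
  exact h

/-- The projection on `v` is centred normal with standard deviation `σ ‖v‖`; standardising turns the
threshold `‖v‖² / 2` into `‖v‖ / (2 σ)`. Ties are null, so the closed half-space may replace the
open one. -/
lemma isotropic_gaussian_halfSpace {σ : ℝ} (hσ : 0 < σ) {v : Signal d} (hv : v ≠ 0) :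
    (multivariateGaussian 0 (σ ^ 2 • (1 : Matrix (Fin d) (Fin d) ℝ))).real
      {z | ‖v‖ ^ 2 / 2 ≤ inner ℝ v z} = gaussianQ (‖v‖ / (2 * σ)) := by
  have hn : 0 < ‖v‖ := norm_pos_iff.2 hv
  have hc : 0 < σ * ‖v‖ := by positivity
  have h1 : {z : Signal d | ‖v‖ ^ 2 / 2 ≤ inner ℝ v z} =
      (fun z => inner ℝ v z) ⁻¹' Set.Ici (‖v‖ ^ 2 / 2) := rfl
  have h2 : gaussianReal 0 ((σ * ‖v‖) ^ 2).toNNReal =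
      (gaussianReal 0 1).map (fun x => σ * ‖v‖ * x) := by
    rw [gaussianReal_map_const_mul]
    congr 1
    · simp
    · ext
      simp [Real.coe_toNNReal _ (sq_nonneg (σ * ‖v‖))]
  have := nullSingletonClass_gaussianReal (μ := 0) (v := 1) one_ne_zero
  rw [h1, ← map_measureReal_apply (by fun_prop) measurableSet_Ici, map_inner_isotropic_gaussian,
    h2, map_measureReal_apply (by fun_prop) measurableSet_Ici, gaussianQ_eq,
    measureReal_def, measureReal_def, measure_congr (Ioi_ae_eq_Ici (μ := gaussianReal 0 1))]
  congr 2
  ext x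
  simp only [Set.mem_preimage, Set.mem_Ici]
  rw [div_le_iff₀ (by positivity), div_le_iff₀ (by positivity), sq]
  constructor
  · intro h
    refine le_of_mul_le_mul_left ?_ hn
    linarith
  · intro h
    nlinarith

end GaussianTail

/-! ### Error rates of two-word codebooks -/

section Codebook

variable {d : ℕ}

/-- The only competitor is `1 - j`, and expanding the squares shows that an error means crossing the
perpendicular bisector. -/
lemma misclassified_two_iff (x : Codebook 2 d) (j : Fin 2) (z : Signal d) :
    Misclassified x j z ↔
      ‖x (1 - j) - x j‖ ^ 2 / 2 ≤ inner ℝ (x (1 - j) - x j) z := by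
  have h1 : Misclassified x j z ↔ ‖x (1 - j) - (x j + z)‖ ^ 2 ≤ ‖x j - (x j + z)‖ ^ 2 := by
    unfold Misclassified
    fin_cases j <;> simp [Fin.exists_fin_two]
  rw [h1, ← sub_sub, norm_sub_sq_real, sub_add_cancel_left, norm_neg]
  constructor <;> intro h <;> linarith

lemma measurableSet_misclassified (x : Codebook 2 d) (j : Fin 2) :
    MeasurableSet {z | Misclassified x j z} := by
  simp only [misclassified_two_iff]
  exact measurableSet_le measurable_const (by fun_prop)

lemma measurable_symbolErrorRate (x : Codebook 2 d) : Measurable (symbolErrorRate x) := by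
  classical
  unfold symbolErrorRate
  refine (Finset.measurable_sum _ fun j _ => ?_).const_mul _
  exact Measurable.ite (measurableSet_misclassified x j) measurable_const measurable_const

/-- The two codewords cannot be misclassified under the same noise. -/
lemma symbolErrorRate_mem (x : Codebook 2 d) (hx : x 0 ≠ x 1) (z : Signal d) :
    symbolErrorRate x z ∈ Set.Icc (0 : ℝ) (1 / 2) := by
  have h : ¬ (Misclassified x 0 z ∧ Misclassified x 1 z) := by
    rintro ⟨h0, h1⟩
    rw [misclassified_two_iff] at h0 h1
    have h2 : 0 < ‖x 1 - x 0‖ := norm_pos_iff.2 (sub_ne_zero.2 hx.symm)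
    have h3 : x 0 - x 1 = -(x 1 - x 0) := (neg_sub _ _).symm
    simp only [sub_zero, sub_self] at h0 h1
    rw [h3, inner_neg_left, norm_neg] at h1
    have := pow_pos h2 2
    linarith
  unfold symbolErrorRate
  rw [Fin.sum_univ_two]
  by_cases h0 : Misclassified x 0 z <;> by_cases h1 : Misclassified x 1 z
  · exact absurd ⟨h0, h1⟩ h
  all_goals simp [h0, h1]

variable {Ω : Type*} [MeasurableSpace Ω] {μ : Measure Ω}

lemma integral_symbolErrorRate (x : Codebook 2 d) (hx : x 0 ≠ x 1) {σ : ℝ} (hσ : 0 < σ)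
    {Z : Ω → Signal d} (hZ : Measurable Z)
    (hlaw : μ.map Z = multivariateGaussian 0 (σ ^ 2 • (1 : Matrix (Fin d) (Fin d) ℝ))) :
    ∫ ω, symbolErrorRate x (Z ω) ∂μ = gaussianQ (‖x 0 - x 1‖ / (2 * σ)) := by
  classical
  rw [← integral_map (f := symbolErrorRate x) hZ.aemeasurable
    (measurable_symbolErrorRate x).aestronglyMeasurable, hlaw]
  have h1 : ∀ j : Fin 2, ∫ z, (if Misclassified x j z then (1 : ℝ) else 0)
      ∂(multivariateGaussian 0 (σ ^ 2 • (1 : Matrix (Fin d) (Fin d) ℝ))) =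
        gaussianQ (‖x 0 - x 1‖ / (2 * σ)) := by
    intro j
    have hne : x (1 - j) - x j ≠ 0 := by
      fin_cases j
      · simpa [sub_ne_zero] using hx.symm
      · simpa [sub_ne_zero] using hx
    have hnorm : ‖x (1 - j) - x j‖ = ‖x 0 - x 1‖ := by
      fin_cases j
      · simpa using norm_sub_rev _ _
      · simp
    rw [← hnorm, ← isotropic_gaussian_halfSpace hσ hne]
    have h2 : (fun z => if Misclassified x j z then (1 : ℝ) else 0) =
        Set.indicator {z | Misclassified x j z} 1 := by
      ext z; simp [Set.indicator_apply]
    rw [h2, integral_indicator_one (measurableSet_misclassified x j)]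
    simp only [misclassified_two_iff]
  unfold symbolErrorRate
  rw [integral_const_mul, integral_finsetSum]
  · simp only [h1, Fin.sum_univ_two]
    push_cast; ring
  · intro j _
    refine Integrable.of_bound (C := 1) (Measurable.aestronglyMeasurable (Measurable.ite
      (measurableSet_misclassified x j) measurable_const measurable_const)) ?_
    filter_upwards with z
    split_ifs <;> simp

lemma expectedErrorProb_le [IsFiniteMeasure μ] {N : ℕ} (x : Fin N → Codebook 2 d)
    {Z : Ω → Signal d} (hZ : Measurable Z) {I : Ω → Fin N} (hI : Measurable I) :
    expectedErrorProb μ (fun ω => x (I ω)) Z ≤ ∫ ω, symbolErrorRate (x (I ω)) (Z ω) ∂μ := by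
  classical
  have hm : ∀ j, MeasurableSet {ω | Misclassified (x (I ω)) j (Z ω)} := by
    intro j
    have : {ω | Misclassified (x (I ω)) j (Z ω)} =
        ⋃ i, (I ⁻¹' {i} ∩ Z ⁻¹' {z | Misclassified (x i) j z}) := by
      ext ω; simp
    rw [this]
    exact MeasurableSet.iUnion fun i => (hI (measurableSet_singleton i)).inter
      (hZ (measurableSet_misclassified (x i) j))
  unfold symbolErrorRate expectedErrorProb
  rw [integral_const_mul, integral_finsetSum]
  · refine mul_le_mul_of_nonneg_left (Finset.sum_le_sum fun j _ => ?_) (by positivity)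
    have h2 : (fun ω => if Misclassified (x (I ω)) j (Z ω) then (1 : ℝ) else 0) =
        Set.indicator {ω | Misclassified (x (I ω)) j (Z ω)} 1 := by
      ext z; simp [Set.indicator_apply]
    rw [h2, integral_indicator_one (hm j)]
    refine measureReal_mono fun ω hω => ?_
    obtain ⟨k, hk, hlt⟩ := hω
    exact ⟨k, hk, hlt.le⟩
  · intro j _
    refine Integrable.of_bound (C := 1) (Measurable.aestronglyMeasurable (Measurable.ite
      (hm j) measurable_const measurable_const)) ?_
    filter_upwards with z
    split_ifs <;> simp

end Codebook

/-! ### Measurability of minimisers and hints -/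

section Measurability

variable {d N T : ℕ} {Ω : Type*}

lemma exists_measurable_argmin [MeasurableSpace Ω] [Nonempty (Fin N)] (f : Fin N → Ω → ℝ)
    (hf : ∀ i, Measurable (f i)) : ∃ g : Ω → Fin N, Measurable g ∧ ∀ ω i, f (g ω) ω ≤ f i ω := by
  suffices h : ∀ s : Finset (Fin N), s.Nonempty → ∃ g : Ω → Fin N, Measurable g ∧
      Measurable (fun ω => f (g ω) ω) ∧ ∀ ω, ∀ i ∈ s, f (g ω) ω ≤ f i ω by
    obtain ⟨g, h1, -, h2⟩ := h Finset.univ Finset.univ_nonempty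
    exact ⟨g, h1, fun ω i => h2 ω i (Finset.mem_univ i)⟩
  intro s hs
  induction hs using Finset.Nonempty.cons_induction with
  | singleton a => exact ⟨fun _ => a, measurable_const, hf a, by simp⟩
  | cons a s _ _ ih =>
    obtain ⟨g, h1, h2, h3⟩ := ih
    have hm : MeasurableSet {ω | f (g ω) ω ≤ f a ω} := measurableSet_le h2 (hf a)
    classical
    refine ⟨fun ω => if f (g ω) ω ≤ f a ω then g ω else a, h1.ite hm measurable_const, ?_, ?_⟩
    · have h4 : (fun ω => f (if f (g ω) ω ≤ f a ω then g ω else a) ω) =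
          fun ω => if f (g ω) ω ≤ f a ω then f (g ω) ω else f a ω := by
        funext ω
        split_ifs <;> rfl
      rw [h4]
      exact h2.ite hm (hf a)
    · intro ω i hi
      rw [Finset.mem_cons] at hi
      dsimp only
      split_ifs with h
      · rcases hi with rfl | hi
        · exact h
        · exact h3 ω i hi
      · rcases hi with rfl | hi
        · exact le_rfl
        · exact (not_le.1 h).le.trans (h3 ω i hi)

lemma measurable_finset_sup_nat [MeasurableSpace Ω] {ι : Type*} (s : Finset ι) (f : ι → Ω → ℕ)
    (hf : ∀ a ∈ s, Measurable (f a)) : Measurable fun ω => s.sup (f · ω) := by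
  classical
  induction s using Finset.induction_on with
  | empty => simp only [Finset.sup_empty]; exact measurable_const
  | insert a s _ ih =>
    simp only [Finset.sup_insert]
    exact (hf a (Finset.mem_insert_self a s)).sup (ih fun b hb => hf b (Finset.mem_insert_of_mem hb))

lemma lastChosen_eq_sup (J : ℕ → Fin N) (i : Fin N) (t : ℕ) :
    lastChosen J i t = (Finset.Ico 1 t).sup fun τ => if J τ = i then τ else 0 := by
  rw [lastChosen]
  apply le_antisymm
  · refine Finset.sup_le fun τ hτ => ?_
    obtain ⟨h1, h2⟩ := Finset.mem_filter.1 hτ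
    refine le_trans ?_ (Finset.le_sup (f := fun τ => if J τ = i then τ else 0) h1)
    simp [h2]
  · refine Finset.sup_le fun τ hτ => ?_
    split_ifs with h
    · exact Finset.le_sup (f := id) (Finset.mem_filter.2 ⟨hτ, h⟩)
    · exact Nat.zero_le _

lemma measurable_hint [MeasurableSpace Ω] {ℓ : ℕ → Ω → Fin N → ℝ} {I : ℕ → Ω → Fin N} {t : ℕ}
    (hℓ : ∀ τ ∈ Finset.Ico 1 t, ∀ i, Measurable fun ω => ℓ τ ω i)
    (hI : ∀ τ ∈ Finset.Ico 1 t, Measurable (I τ)) (i : Fin N) :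
    Measurable fun ω => hint (ℓ · ω) (I · ω) t i := by
  have h1 : Measurable fun ω => lastChosen (I · ω) i t := by
    simp only [lastChosen_eq_sup]
    exact measurable_finset_sup_nat _ _ fun τ hτ =>
      Measurable.ite (hI τ hτ (measurableSet_singleton i)) measurable_const measurable_const
  -- Splits over the finitely many values of the last choice; the default value `0` lies outside
  -- `Finset.Ico 1 t`, so the sum then vanishes as the hint does.
  have h2 : (fun ω => hint (ℓ · ω) (I · ω) t i) =
      fun ω => ∑ τ ∈ Finset.Ico 1 t, if lastChosen (I · ω) i t = τ then ℓ τ ω i else 0 := by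
    funext ω
    rw [Finset.sum_ite_eq]
    by_cases h : lastChosen (I · ω) i t = 0
    · simp [hint, h]
    · simp only [hint, h, if_false, if_pos (lastChosen_spec h).1]
  rw [h2]
  exact Finset.measurable_sum _ fun τ hτ =>
    Measurable.ite (h1 (measurableSet_singleton τ)) (hℓ τ hτ i) measurable_const

/-- The information generated by the noise of all rounds. -/
abbrev noiseAlgebra (T : ℕ) (Z : ℕ → Ω → Signal d) : MeasurableSpace Ω :=
  ⨆ τ ∈ Finset.Icc 1 T, MeasurableSpace.comap (Z τ) inferInstance

lemma noiseAlgebra_le_noiseAndPast (T : ℕ) (Z : ℕ → Ω → Signal d) (I : ℕ → Ω → Fin N) (t : ℕ) :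
    noiseAlgebra T Z ≤ noiseAndPast T Z I t := le_sup_left

lemma measurable_noise {Z : ℕ → Ω → Signal d} {t : ℕ} (ht : t ∈ Finset.Icc 1 T) :
    Measurable[noiseAlgebra T Z] (Z t) :=
  Measurable.of_comap_le
    (le_iSup₂_of_le (f := fun τ _ => MeasurableSpace.comap (Z τ) inferInstance) t ht le_rfl)

lemma measurable_past {Z : ℕ → Ω → Signal d} {I : ℕ → Ω → Fin N} {t τ : ℕ}
    (hτ : τ ∈ Finset.Ico 1 t) : Measurable[noiseAndPast T Z I t] (I τ) :=
  Measurable.of_comap_le (le_trans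
    (le_iSup₂_of_le (f := fun τ _ => MeasurableSpace.comap (I τ) inferInstance) τ hτ le_rfl)
    le_sup_right)

lemma noiseAndPast_le [mΩ : MeasurableSpace Ω] {Z : ℕ → Ω → Signal d} {I : ℕ → Ω → Fin N} {t : ℕ}
    (hZ : ∀ t ∈ Finset.Icc 1 T, Measurable (Z t)) (hI : ∀ t ∈ Finset.Icc 1 T, Measurable (I t))
    (ht : t ∈ Finset.Icc 1 T) : noiseAndPast T Z I t ≤ mΩ := by
  refine sup_le (iSup₂_le fun τ hτ => (hZ τ hτ).comap_le) (iSup₂_le fun τ hτ => (hI τ ?_).comap_le)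
  simp only [Finset.mem_Icc, Finset.mem_Ico] at *
  omega

end Measurability

/-! ### Unbiasedness of the loss estimator -/

section Sampling

variable {d N T : ℕ} {Ω : Type*} [mΩ : MeasurableSpace Ω] {μ : Measure Ω} [IsProbabilityMeasure μ]

lemma integral_mul_indicator_eq {m : MeasurableSpace Ω} (hm : m ≤ mΩ) {f v h : Ω → ℝ}
    (hf : Integrable f μ) (hv : μ[f | m] =ᵐ[μ] v) (hh : AEStronglyMeasurable[m] h μ)
    (hhf : Integrable (fun ω => h ω * f ω) μ) : ∫ ω, h ω * f ω ∂μ = ∫ ω, h ω * v ω ∂μ := by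
  rw [← integral_condExp hm]
  refine integral_congr_ae ?_
  filter_upwards [condExp_mul_of_aestronglyMeasurable_left hh hhf hf, hv] with ω h1 h2
  rw [← h2]
  exact h1

variable {η₀ : ℝ} {x : Fin N → Codebook 2 d} {Z : ℕ → Ω → Signal d} {I : ℕ → Ω → Fin N}
  {w w' : ℕ → Ω → Fin N → ℝ} {η : ℕ → Ω → ℝ} {s : ℕ → Ω → ℕ}

lemma integrable_of_measurable_of_mem {f : Ω → ℝ} {a b : ℝ} (hf : AEStronglyMeasurable f μ)
    (h : ∀ ω, f ω ∈ Set.Icc a b) : Integrable f μ :=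
  Integrable.of_mem_Icc a b hf.aemeasurable (ae_of_all _ h)

/-- In expectation, the estimated regret of a round is its true regret. -/
theorem IsCodebookLearner.integral_estimatedRegret (H : IsCodebookLearner μ η₀ T x Z I w w' η s)
    (h0 : 0 < η₀) (h01 : η₀ ≤ 1) (hx : ∀ i, x i 0 ≠ x i 1)
    (hZ : ∀ t ∈ Finset.Icc 1 T, Measurable (Z t)) {t : ℕ} (ht : t ∈ Finset.Icc 1 T)
    {u : Ω → Fin N → ℝ} (hu : ∀ i, Measurable[noiseAlgebra T Z] fun ω => u ω i)
    (hu1 : ∀ ω i, u ω i ∈ Set.Icc (0 : ℝ) 1) :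
    Integrable (fun ω => estimatedRegret (lossSeq x (Z · ω)) (I · ω) (w · ω) (u ω) t) μ ∧
    ∫ ω, estimatedRegret (lossSeq x (Z · ω)) (I · ω) (w · ω) (u ω) t ∂μ =
      ∫ ω, symbolErrorRate (x (I t ω)) (Z t ω) ∂μ -
        ∫ ω, ∑ i, u ω i * symbolErrorRate (x i) (Z t ω) ∂μ := by
  classical
  have hℓ : ∀ ω, ∀ t ∈ Finset.Icc 1 T, ∀ i, lossSeq x (Z · ω) t i ∈ Set.Icc (0 : ℝ) (1 / 2) :=
    fun ω t _ i => symbolErrorRate_mem _ (hx i) _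
  have hm := noiseAndPast_le hZ H.measurable_choice ht
  have hnm : noiseAlgebra T Z ≤ noiseAndPast T Z I t := noiseAlgebra_le_noiseAndPast T Z I t
  set c : Fin N → Ω → ℝ := fun i ω => if I t ω = i then (1 : ℝ) else 0 with hc
  -- The weights `w t` are not assumed measurable; this conditional expectation is an almost
  -- everywhere equal version that is.
  set W : Fin N → Ω → ℝ := fun i => μ[c i | noiseAndPast T Z I t] with hW
  set L : Fin N → Ω → ℝ := fun i ω => symbolErrorRate (x i) (Z t ω) with hL
  set M : Fin N → Ω → ℝ := fun i ω => hint (lossSeq x (Z · ω)) (I · ω) t i with hM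
  have hcm : ∀ i, Measurable (c i) := fun i => Measurable.ite
    (H.measurable_choice t ht (measurableSet_singleton i)) measurable_const measurable_const
  have hc1 : ∀ i ω, c i ω ∈ Set.Icc (0 : ℝ) 1 := fun i ω => by
    simp only [hc]; split_ifs <;> simp
  have hci : ∀ i, Integrable (c i) μ := fun i =>
    integrable_of_measurable_of_mem (hcm i).aestronglyMeasurable (hc1 i)
  have hWm : ∀ i, Measurable[noiseAndPast T Z I t] (W i) :=
    fun i => stronglyMeasurable_condExp.measurable
  have hWw : ∀ i, W i =ᵐ[μ] fun ω => w t ω i := fun i => H.sampling t ht i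
  have hwm : ∀ i, AEStronglyMeasurable (fun ω => w t ω i) μ := fun i =>
    ⟨W i, stronglyMeasurable_condExp.mono hm, (hWw i).symm⟩
  have hLm : ∀ i, Measurable[noiseAndPast T Z I t] (L i) := fun i =>
    (measurable_symbolErrorRate (x i)).comp ((measurable_noise ht).mono hnm le_rfl)
  have hMm : ∀ i, Measurable[noiseAndPast T Z I t] (M i) := fun i => by
    refine @measurable_hint N Ω (noiseAndPast T Z I t) (fun τ ω => lossSeq x (Z · ω) τ) I t
      (fun τ hτ i => ?_)
      (fun τ hτ => measurable_past hτ) i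
    exact (measurable_symbolErrorRate (x i)).comp ((measurable_noise
      (by simp only [Finset.mem_Icc, Finset.mem_Ico] at *; omega)).mono hnm le_rfl)
  have hum : ∀ i, Measurable[noiseAndPast T Z I t] fun ω => u ω i := fun i => (hu i).mono hnm le_rfl
  have hL1 : ∀ i ω, L i ω ∈ Set.Icc (0 : ℝ) (1 / 2) := fun i ω => symbolErrorRate_mem _ (hx i) _
  have hM1 : ∀ i ω, M i ω ∈ Set.Icc (0 : ℝ) (1 / 2) := fun i ω =>
    hint_mem (by norm_num) (fun τ hτ i => hℓ ω τ
      (by simp only [Finset.mem_Icc, Finset.mem_Ico] at *; omega) i) i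
  have hwp : ∀ ω, w t ω ∈ positiveSimplex N := fun ω => ((H.trajectory ω).action t ht).1
  have hw1 : ∀ ω i, w t ω i ∈ Set.Icc (0 : ℝ) 1 := fun ω i =>
    ⟨((hwp ω).2 i).le, by
      rw [← (hwp ω).1.2]
      exact Finset.single_le_sum (fun j _ => ((hwp ω).2 j).le) (Finset.mem_univ i)⟩
  have hwinv : ∀ ω i, 1 / w t ω i ≤ 5 ^ t * N := fun ω i =>
    (H.trajectory ω).one_div_le h0 h01 (hℓ ω) ht i
  set h : Fin N → Ω → ℝ := fun i ω => (w t ω i - u ω i) * (L i ω - M i ω) * (1 / w t ω i) with hh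
  have hhm : ∀ i, AEStronglyMeasurable[noiseAndPast T Z I t] (h i) μ := fun i => by
    refine ⟨fun ω => (W i ω - u ω i) * (L i ω - M i ω) * (1 / W i ω), ?_, ?_⟩
    · refine Measurable.stronglyMeasurable ?_
      exact (((hWm i).sub (hum i)).mul ((hLm i).sub (hMm i))).mul (measurable_const.div (hWm i))
    · filter_upwards [hWw i] with ω hω
      simp only [hh, hω]
  have hhb : ∀ i ω, |h i ω| ≤ 5 ^ t * N := fun i ω => by
    simp only [hh, abs_mul]
    have e1 : |w t ω i - u ω i| ≤ 1 := abs_le.2 ⟨by linarith [(hw1 ω i).1, (hu1 ω i).2],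
      by linarith [(hw1 ω i).2, (hu1 ω i).1]⟩
    have e2 : |L i ω - M i ω| ≤ 1 := abs_le.2 ⟨by linarith [(hL1 i ω).1, (hM1 i ω).2],
      by linarith [(hL1 i ω).2, (hM1 i ω).1]⟩
    have e3 : |1 / w t ω i| ≤ 5 ^ t * N := by
      rw [abs_of_pos (one_div_pos.2 ((hwp ω).2 i))]; exact hwinv ω i
    calc _ ≤ 1 * 1 * (5 ^ t * (N : ℝ)) := by gcongr
      _ = _ := by ring
  have hhc : ∀ i, Integrable (fun ω => h i ω * c i ω) μ := fun i => by
    refine Integrable.of_bound (C := 5 ^ t * N)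
      (((hhm i).mono hm).mul (hcm i).aestronglyMeasurable) (ae_of_all _ fun ω => ?_)
    rw [Real.norm_eq_abs, abs_mul]
    have := hc1 i ω
    rw [abs_of_nonneg this.1]
    nlinarith [hhb i ω, abs_nonneg (h i ω), this.1, this.2]
  have hLasm : ∀ i, AEStronglyMeasurable (L i) μ := fun i =>
    ((hLm i).mono hm le_rfl).aestronglyMeasurable
  have hMasm : ∀ i, AEStronglyMeasurable (M i) μ := fun i =>
    ((hMm i).mono hm le_rfl).aestronglyMeasurable
  have huasm : ∀ i, AEStronglyMeasurable (fun ω => u ω i) μ := fun i =>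
    ((hum i).mono hm le_rfl).aestronglyMeasurable
  have hLc : ∀ i, Integrable (fun ω => L i ω * c i ω) μ := fun i => by
    refine integrable_of_measurable_of_mem (a := 0) (b := 1)
      ((hLasm i).mul (hcm i).aestronglyMeasurable) fun ω => ?_
    obtain ⟨a1, a2⟩ := hL1 i ω
    obtain ⟨b1, b2⟩ := hc1 i ω
    exact ⟨by positivity, by nlinarith⟩
  have hLw : ∀ i, Integrable (fun ω => L i ω * w t ω i) μ := fun i => by
    refine integrable_of_measurable_of_mem (a := 0) (b := 1) ((hLasm i).mul (hwm i)) fun ω => ?_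
    obtain ⟨a1, a2⟩ := hL1 i ω
    obtain ⟨b1, b2⟩ := hw1 ω i
    exact ⟨by positivity, by nlinarith⟩
  have huL : ∀ i, Integrable (fun ω => u ω i * L i ω) μ := fun i => by
    refine integrable_of_measurable_of_mem (a := 0) (b := 1) ((huasm i).mul (hLasm i)) fun ω => ?_
    obtain ⟨a1, a2⟩ := hL1 i ω
    obtain ⟨b1, b2⟩ := hu1 ω i
    exact ⟨by positivity, by nlinarith⟩
  have hwuM : ∀ i, Integrable (fun ω => (w t ω i - u ω i) * M i ω) μ := fun i => by
    refine integrable_of_measurable_of_mem (a := -1) (b := 1)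
      (((hwm i).sub (huasm i)).mul (hMasm i)) fun ω => ?_
    obtain ⟨a1, a2⟩ := hM1 i ω
    obtain ⟨b1, b2⟩ := hu1 ω i
    obtain ⟨c1, c2⟩ := hw1 ω i
    exact ⟨by nlinarith, by nlinarith⟩
  have hest : (fun ω => estimatedRegret (lossSeq x (Z · ω)) (I · ω) (w · ω) (u ω) t) =
      fun ω => ∑ i, (h i ω * c i ω + (w t ω i - u ω i) * M i ω) := by
    funext ω
    simp only [estimatedRegret, lossEstimator, hh, hc, hM, hL, lossSeq]
    exact Finset.sum_congr rfl fun i _ => by ring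
  have hterm : ∀ i, ∫ ω, (h i ω * c i ω + (w t ω i - u ω i) * M i ω) ∂μ =
      ∫ ω, L i ω * c i ω ∂μ - ∫ ω, u ω i * L i ω ∂μ := fun i => by
    rw [integral_add (hhc i) (hwuM i), integral_mul_indicator_eq hm (hci i) (hWw i) (hhm i) (hhc i),
      integral_mul_indicator_eq hm (hci i) (hWw i)
        (⟨L i, (hLm i).stronglyMeasurable, Filter.EventuallyEq.rfl⟩) (hLc i),
      ← integral_sub (hLw i) (huL i)]
    -- Conditioning replaces the indicator by `w`, which cancels the importance weight `1 / w`; the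
    -- hint then drops out.
    have h1 : (fun ω => h i ω * w t ω i) =
        fun ω => (L i ω * w t ω i - u ω i * L i ω) - (w t ω i - u ω i) * M i ω := by
      funext ω
      have := ((hwp ω).2 i).ne'
      simp only [hh]
      field_simp
    rw [h1, integral_sub (f := fun ω => L i ω * w t ω i - u ω i * L i ω)
      ((hLw i).sub (huL i)) (hwuM i)]
    ring
  have hint : ∀ i ∈ Finset.univ,
      Integrable (fun ω => h i ω * c i ω + (w t ω i - u ω i) * M i ω) μ :=
    fun i _ => (hhc i).add (hwuM i)
  rw [hest]
  refine ⟨integrable_finsetSum _ hint, ?_⟩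
  rw [integral_finsetSum _ hint]
  simp only [hterm]
  rw [Finset.sum_sub_distrib, ← integral_finsetSum _ fun i _ => hLc i,
    ← integral_finsetSum _ fun i _ => huL i]
  congr 2
  funext ω
  simp [hL, hc]

end Sampling

/-! ### Expected regret and the final balancing -/

section ExpectedRegret

variable {d N T : ℕ} {Ω : Type*} [mΩ : MeasurableSpace Ω] {μ : Measure Ω} [IsProbabilityMeasure μ]
  {η₀ : ℝ} {x : Fin N → Codebook 2 d} {Z : ℕ → Ω → Signal d} {I : ℕ → Ω → Fin N}
  {w w' : ℕ → Ω → Fin N → ℝ} {η : ℕ → Ω → ℝ} {s : ℕ → Ω → ℕ}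

lemma integrable_selected_symbolErrorRate (hx : ∀ i, x i 0 ≠ x i 1) {J : Ω → Fin N}
    (hJ : Measurable J) {Y : Ω → Signal d} (hY : Measurable Y) :
    Integrable (fun ω => symbolErrorRate (x (J ω)) (Y ω)) μ := by
  classical
  have h1 : (fun ω => symbolErrorRate (x (J ω)) (Y ω)) =
      fun ω => ∑ i, if J ω = i then symbolErrorRate (x i) (Y ω) else 0 := by
    funext ω; simp
  refine integrable_of_measurable_of_mem (a := 0) (b := 1 / 2) ?_ fun ω =>
    symbolErrorRate_mem _ (hx _) _
  rw [h1]
  refine (Finset.measurable_sum _ fun i _ => ?_).aestronglyMeasurable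
  exact Measurable.ite (hJ (measurableSet_singleton i))
    ((measurable_symbolErrorRate (x i)).comp hY) measurable_const

lemma IsCodebookLearner.integral_sum_estimatedRegret
    (H : IsCodebookLearner μ η₀ T x Z I w w' η s)
    (h0 : 0 < η₀) (h01 : η₀ ≤ 1) (hx : ∀ i, x i 0 ≠ x i 1)
    (hZ : ∀ t ∈ Finset.Icc 1 T, Measurable (Z t))
    {u : Ω → Fin N → ℝ} (hu : ∀ i, Measurable[noiseAlgebra T Z] fun ω => u ω i)
    (hu1 : ∀ ω i, u ω i ∈ Set.Icc (0 : ℝ) 1) {g : Ω → ℝ} (hg : Integrable g μ)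
    (hle : ∀ ω, ∑ t ∈ Finset.Icc 1 T,
      estimatedRegret (lossSeq x (Z · ω)) (I · ω) (w · ω) (u ω) t ≤ g ω) :
    ∑ t ∈ Finset.Icc 1 T, ∫ ω, symbolErrorRate (x (I t ω)) (Z t ω) ∂μ -
      ∑ t ∈ Finset.Icc 1 T, ∫ ω, ∑ i, u ω i * symbolErrorRate (x i) (Z t ω) ∂μ ≤ ∫ ω, g ω ∂μ := by
  have key := fun t (ht : t ∈ Finset.Icc 1 T) =>
    H.integral_estimatedRegret h0 h01 hx hZ ht hu hu1
  rw [← Finset.sum_sub_distrib, ← Finset.sum_congr rfl fun t ht => (key t ht).2,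
    ← integral_finsetSum _ fun t ht => (key t ht).1]
  exact integral_mono (integrable_finsetSum _ fun t ht => (key t ht).1) hg hle

lemma integrable_symbolErrorRate (hx : ∀ i, x i 0 ≠ x i 1) {Y : Ω → Signal d} (hY : Measurable Y)
    (i : Fin N) : Integrable (fun ω => symbolErrorRate (x i) (Y ω)) μ :=
  integrable_selected_symbolErrorRate hx (J := fun _ => i) measurable_const hY

/-- The algorithm loses at most twice as much as a uniformly random choice. -/
theorem IsCodebookLearner.sum_integral_loss_le (H : IsCodebookLearner μ η₀ T x Z I w w' η s)
    (h0 : 0 < η₀) (h01 : η₀ ≤ 1 / 162) (hx : ∀ i, x i 0 ≠ x i 1)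
    (hZ : ∀ t ∈ Finset.Icc 1 T, Measurable (Z t)) :
    ∑ t ∈ Finset.Icc 1 T, ∫ ω, symbolErrorRate (x (I t ω)) (Z t ω) ∂μ ≤
      2 * ((∑ i, ∑ t ∈ Finset.Icc 1 T, ∫ ω, symbolErrorRate (x i) (Z t ω) ∂μ) / N) := by
  have hη1 : η₀ ≤ 1 := h01.trans (by norm_num)
  have hint : ∀ t ∈ Finset.Icc 1 T, Integrable (fun ω => symbolErrorRate (x (I t ω)) (Z t ω)) μ :=
    fun t ht => integrable_selected_symbolErrorRate hx (H.measurable_choice t ht) (hZ t ht)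
  have hℓ : ∀ ω, ∀ t ∈ Finset.Icc 1 T, ∀ i, lossSeq x (Z · ω) t i ∈ Set.Icc (0 : ℝ) (1 / 2) :=
    fun ω t _ i => symbolErrorRate_mem _ (hx i) _
  have h1 := H.integral_sum_estimatedRegret h0 hη1 hx hZ (u := fun _ _ => 1 / N)
    (fun _ => measurable_const) (fun _ i => ⟨by positivity, by
      have : (1 : ℝ) ≤ N := by exact_mod_cast i.pos
      exact div_le_one_of_le₀ this (by positivity)⟩)
    (g := fun ω => 2 * η₀ * ∑ t ∈ Finset.Icc 1 T, symbolErrorRate (x (I t ω)) (Z t ω))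
    ((integrable_finsetSum _ hint).const_mul _) (fun ω => by
      refine ((H.trajectory ω).sum_estimatedRegret_uniform_le h0 hη1 (hℓ ω)).trans ?_
      exact mul_le_mul_of_nonneg_left (sum_deviation_sq_le (hℓ ω)) (by positivity))
  rw [integral_const_mul, integral_finsetSum _ hint] at h1
  have h2 : ∑ t ∈ Finset.Icc 1 T, ∫ ω, ∑ i, 1 / (N : ℝ) * symbolErrorRate (x i) (Z t ω) ∂μ =
      (∑ i, ∑ t ∈ Finset.Icc 1 T, ∫ ω, symbolErrorRate (x i) (Z t ω) ∂μ) / N := by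
    rw [Finset.sum_comm, Finset.sum_div]
    refine Finset.sum_congr rfl fun t ht => ?_
    rw [integral_finsetSum _ fun i _ => (integrable_symbolErrorRate hx (hZ t ht) i).const_mul _,
      Finset.sum_div]
    exact Finset.sum_congr rfl fun i _ => by rw [integral_const_mul]; ring
  rw [h2] at h1
  have h3 : 0 ≤ ∑ t ∈ Finset.Icc 1 T, ∫ ω, symbolErrorRate (x (I t ω)) (Z t ω) ∂μ :=
    Finset.sum_nonneg fun t _ => integral_nonneg fun ω => (symbolErrorRate_mem _ (hx _) _).1
  -- Since `2 η₀ ≤ 1/81`, the term `2 η₀ A` is absorbed on the left.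
  nlinarith

/-- The comparator that mixes the uniform distribution into the choice `i`. -/
def mixedVertex (N T : ℕ) (i j : Fin N) : ℝ :=
  (1 - 1 / (T : ℝ)) * (if i = j then 1 else 0) + 1 / ((N : ℝ) * T)

lemma mixedVertex_spec (hT : 1 ≤ T) (i : Fin N) :
    mixedVertex N T i ∈ positiveSimplex N ∧ ∀ j, 1 / ((N : ℝ) * T) ≤ mixedVertex N T i j := by
  have hN : (0 : ℝ) < N := by exact_mod_cast i.pos
  have hT0 : (1 : ℝ) ≤ T := by exact_mod_cast hT
  have h1 : 1 / (T : ℝ) ≤ 1 := div_le_one_of_le₀ hT0 (by positivity)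
  have h2 : 0 < 1 / ((N : ℝ) * T) := by positivity
  have h3 : ∀ j, 1 / ((N : ℝ) * T) ≤ mixedVertex N T i j := fun j => by
    have : 0 ≤ (1 - 1 / (T : ℝ)) * (if i = j then 1 else 0) :=
      mul_nonneg (by linarith) (by split_ifs <;> norm_num)
    unfold mixedVertex
    linarith
  refine ⟨⟨⟨fun j => h2.le.trans (h3 j), ?_⟩, fun j => h2.trans_le (h3 j)⟩, h3⟩
  simp only [mixedVertex, Finset.sum_add_distrib, ← Finset.mul_sum, Finset.sum_ite_eq,
    Finset.mem_univ, if_true, Finset.sum_const, Finset.card_univ, Fintype.card_fin, nsmul_eq_mul]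
  field_simp
  ring

theorem IsCodebookLearner.regret_le_of_pos (H : IsCodebookLearner μ η₀ T x Z I w w' η s)
    (h0 : 0 < η₀) (h01 : η₀ ≤ 1) (hT : 1 ≤ T) (hx : ∀ i, x i 0 ≠ x i 1)
    (hZ : ∀ t ∈ Finset.Icc 1 T, Measurable (Z t)) {iStar : Ω → Fin N} (hiStar : Measurable iStar)
    {κ : ℝ} (hκ : 0 < κ) :
    ∑ t ∈ Finset.Icc 1 T, ∫ ω, symbolErrorRate (x (I t ω)) (Z t ω) ∂μ -
        ∑ t ∈ Finset.Icc 1 T, ∫ ω, symbolErrorRate (x (iStar ω)) (Z t ω) ∂μ ≤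
      10 / 3 * (N * Real.log T / η₀ + κ * (N * Real.log T) +
        3 / κ * ∑ t ∈ Finset.Icc 1 T, ∫ ω, symbolErrorRate (x (I t ω)) (Z t ω) ∂μ) + 1 +
      (∑ i, ∑ t ∈ Finset.Icc 1 T, ∫ ω, symbolErrorRate (x i) (Z t ω) ∂μ) / (N * T) := by
  have hT0 : (1 : ℝ) ≤ T := by exact_mod_cast hT
  have hint : ∀ t ∈ Finset.Icc 1 T, Integrable (fun ω => symbolErrorRate (x (I t ω)) (Z t ω)) μ :=
    fun t ht => integrable_selected_symbolErrorRate hx (H.measurable_choice t ht) (hZ t ht)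
  have hℓ : ∀ ω, ∀ t ∈ Finset.Icc 1 T, ∀ i, lossSeq x (Z · ω) t i ∈ Set.Icc (0 : ℝ) (1 / 2) :=
    fun ω t _ i => symbolErrorRate_mem _ (hx i) _
  have hΩ : Nonempty Ω := (inferInstance : NeZero μ).out |> fun h => by
    by_contra hne
    rw [not_nonempty_iff] at hne
    exact h (Measure.eq_zero_of_isEmpty μ)
  have hN : Nonempty (Fin N) := ⟨iStar hΩ.some⟩
  -- `iStar` may depend on the algorithm's own randomness, while unbiasedness needs a comparator
  -- determined by the noise. Such a hindsight minimiser `J` has cumulative loss at most that of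
  -- `iStar`.
  obtain ⟨J, hJ, hJmin⟩ := @exists_measurable_argmin N Ω (noiseAlgebra T Z) hN
    (fun i ω => ∑ t ∈ Finset.Icc 1 T, symbolErrorRate (x i) (Z t ω)) fun i =>
      Finset.measurable_sum _ fun t ht => (measurable_symbolErrorRate (x i)).comp
        (measurable_noise ht)
  have hnle : noiseAlgebra T Z ≤ mΩ := iSup₂_le fun τ hτ => (hZ τ hτ).comap_le
  have hspec := fun ω => mixedVertex_spec hT (J ω)
  have i1 : Integrable (fun ω => 3 / κ * ∑ t ∈ Finset.Icc 1 T,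
      symbolErrorRate (x (I t ω)) (Z t ω)) μ := (integrable_finsetSum _ hint).const_mul _
  have i2 : Integrable (fun ω => N * Real.log T / η₀ + κ * (N * Real.log T) +
      3 / κ * ∑ t ∈ Finset.Icc 1 T, symbolErrorRate (x (I t ω)) (Z t ω)) μ :=
    (integrable_const _).add i1
  have hg : Integrable (fun ω => 10 / 3 * (N * Real.log T / η₀ + κ * (N * Real.log T) +
      3 / κ * ∑ t ∈ Finset.Icc 1 T, symbolErrorRate (x (I t ω)) (Z t ω)) + 1) μ :=
    (i2.const_mul _).add (integrable_const _)
  have h1 := H.integral_sum_estimatedRegret h0 h01 hx hZ (u := fun ω => mixedVertex N T (J ω))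
    (fun i => ((@measurable_from_top _ _ _ fun j => mixedVertex N T j i)).comp hJ) (fun ω i =>
      ⟨((hspec ω).1.2 i).le, by
        rw [← (hspec ω).1.1.2]
        exact Finset.single_le_sum (fun j _ => ((hspec ω).1.2 j).le) (Finset.mem_univ i)⟩)
    (g := fun ω => 10 / 3 * (N * Real.log T / η₀ + κ * (N * Real.log T) +
        3 / κ * ∑ t ∈ Finset.Icc 1 T, symbolErrorRate (x (I t ω)) (Z t ω)) + 1)
    hg (fun ω => by
      refine ((H.trajectory ω).sum_estimatedRegret_le h0 h01 hT (hℓ ω) (hspec ω).1 (hspec ω).2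
        hκ).trans ?_
      have h := mul_le_mul_of_nonneg_left (sum_deviation_sq_le (I := (I · ω)) (hℓ ω))
        (by positivity : 0 ≤ 3 / κ)
      simp only [lossSeq] at h ⊢
      linarith)
  have h2 : ∫ ω, (10 / 3 * (N * Real.log T / η₀ + κ * (N * Real.log T) +
        3 / κ * ∑ t ∈ Finset.Icc 1 T, symbolErrorRate (x (I t ω)) (Z t ω)) + 1) ∂μ =
      10 / 3 * (N * Real.log T / η₀ + κ * (N * Real.log T) +
        3 / κ * ∑ t ∈ Finset.Icc 1 T, ∫ ω, symbolErrorRate (x (I t ω)) (Z t ω) ∂μ) + 1 := by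
    rw [integral_add (i2.const_mul _) (integrable_const _), integral_const_mul,
      integral_add (integrable_const _) i1, integral_const_mul, integral_finsetSum _ hint]
    simp
  have h3 : ∑ t ∈ Finset.Icc 1 T, ∫ ω, ∑ i, mixedVertex N T (J ω) i *
      symbolErrorRate (x i) (Z t ω) ∂μ ≤
        ∑ t ∈ Finset.Icc 1 T, ∫ ω, symbolErrorRate (x (iStar ω)) (Z t ω) ∂μ +
        (∑ i, ∑ t ∈ Finset.Icc 1 T, ∫ ω, symbolErrorRate (x i) (Z t ω) ∂μ) / (N * T) := by
    have e1 : ∀ t ∈ Finset.Icc 1 T, ∫ ω, ∑ i, mixedVertex N T (J ω) i *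
        symbolErrorRate (x i) (Z t ω) ∂μ =
          (1 - 1 / (T : ℝ)) * ∫ ω, symbolErrorRate (x (J ω)) (Z t ω) ∂μ +
            1 / (N * T) * ∑ i, ∫ ω, symbolErrorRate (x i) (Z t ω) ∂μ := by
      intro t ht
      have e2 : (fun ω => ∑ i, mixedVertex N T (J ω) i * symbolErrorRate (x i) (Z t ω)) =
          fun ω => (1 - 1 / (T : ℝ)) * symbolErrorRate (x (J ω)) (Z t ω) +
            1 / (N * T) * ∑ i, symbolErrorRate (x i) (Z t ω) := by
        funext ω
        simp [mixedVertex, add_mul, Finset.sum_add_distrib, Finset.mul_sum]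
      have i2 : ∀ i ∈ Finset.univ, Integrable (fun ω => symbolErrorRate (x i) (Z t ω)) μ :=
        fun i _ => integrable_symbolErrorRate hx (hZ t ht) i
      rw [e2, integral_add ((integrable_selected_symbolErrorRate hx (hJ.mono hnle le_rfl)
        (hZ t ht)).const_mul _) ((integrable_finsetSum _ i2).const_mul _), integral_const_mul,
        integral_const_mul, integral_finsetSum _ i2]
    have e3 : ∑ t ∈ Finset.Icc 1 T, ∫ ω, symbolErrorRate (x (J ω)) (Z t ω) ∂μ ≤
        ∑ t ∈ Finset.Icc 1 T, ∫ ω, symbolErrorRate (x (iStar ω)) (Z t ω) ∂μ := by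
      have i3 : ∀ t ∈ Finset.Icc 1 T, Integrable (fun ω => symbolErrorRate (x (J ω)) (Z t ω)) μ :=
        fun t ht => integrable_selected_symbolErrorRate hx (hJ.mono hnle le_rfl) (hZ t ht)
      have i4 : ∀ t ∈ Finset.Icc 1 T,
          Integrable (fun ω => symbolErrorRate (x (iStar ω)) (Z t ω)) μ :=
        fun t ht => integrable_selected_symbolErrorRate hx hiStar (hZ t ht)
      rw [← integral_finsetSum _ i3, ← integral_finsetSum _ i4]
      exact integral_mono (integrable_finsetSum _ i3) (integrable_finsetSum _ i4)
        fun ω => hJmin ω (iStar ω)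
    have e4 : 0 ≤ ∑ t ∈ Finset.Icc 1 T, ∫ ω, symbolErrorRate (x (J ω)) (Z t ω) ∂μ :=
      Finset.sum_nonneg fun t _ => integral_nonneg fun ω => (symbolErrorRate_mem _ (hx _) _).1
    have e5 : (0 : ℝ) ≤ 1 / T := by positivity
    rw [Finset.sum_congr rfl e1, Finset.sum_add_distrib, ← Finset.mul_sum, ← Finset.mul_sum,
      Finset.sum_comm (s := Finset.Icc 1 T), one_div_mul_eq_div ((N : ℝ) * T)]
    refine add_le_add_left (le_trans ?_ e3) _
    nlinarith
  rw [h2] at h1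
  linarith

/-- Two regimes, split at `√S = n`: below, the crude bound on `A` suffices; above, `κ = √S / n`
makes `κ n l = l √S` and `3 A / κ ≤ 6 √S`, while `n` and the constants are at most `√S`. -/
lemma le_mul_sqrt_of_min_bounds {A B S R n l η₀ : ℝ} (h0 : 0 < η₀) (hn : 1 ≤ n) (hl : 0 ≤ l)
    (hS0 : 0 ≤ S) (hB0 : 0 ≤ B) (hR : R ≤ 1) (hA : A ≤ 2 * (S / n))
    (h : ∀ κ, 0 < κ → A - B ≤ 10 / 3 * (n * l / η₀ + κ * (n * l) + 3 / κ * A) + 1 + R) :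
    A - B ≤ (4 / η₀ + 30) * (1 + l) * Real.sqrt S := by
  obtain ⟨r, hr0, hrS, hr⟩ : ∃ r, 0 ≤ r ∧ r * r = S ∧ Real.sqrt S = r :=
    ⟨Real.sqrt S, Real.sqrt_nonneg S, Real.mul_self_sqrt hS0, rfl⟩
  rw [hr]
  have hn0 : 0 < n := by linarith
  have hprod2 : 0 ≤ l * r := by positivity
  have hprod3 : 0 ≤ 1 / η₀ * r := by positivity
  have hprod4 : 0 ≤ 1 / η₀ * l * r := by positivity
  have hgoal : (4 / η₀ + 30) * (1 + l) * r = 4 * (1 / η₀ * r) +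
    4 * (1 / η₀ * l * r) + 30 * r + 30 * (l * r) := by ring
  rw [hgoal]
  rcases le_or_gt r n with hle | hlt
  · have h1 : S / n ≤ r := by
      rw [div_le_iff₀ hn0, ← hrS]
      exact mul_le_mul_of_nonneg_left hle hr0
    linarith
  · have hrpos : 0 < r := by linarith
    have h1 := h (r / n) (by positivity)
    have h2 : r / n * (n * l) = l * r := by field_simp
    have h3 : n * l / η₀ ≤ 1 / η₀ * l * r := by
      calc _ = 1 / η₀ * l * n := by ring
        _ ≤ _ := by gcongr
    have h4 : 3 / (r / n) * A ≤ 6 * r := by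
      calc _ ≤ 3 / (r / n) * (2 * (S / n)) := by gcongr
        _ = 6 * r := by rw [← hrS]; field_simp; norm_num
    rw [h2] at h1
    linarith

theorem IsCodebookLearner.regret_le (H : IsCodebookLearner μ η₀ T x Z I w w' η s)
    (h0 : 0 < η₀) (h01 : η₀ ≤ 1 / 162) (hT : 1 ≤ T) (hx : ∀ i, x i 0 ≠ x i 1)
    (hZ : ∀ t ∈ Finset.Icc 1 T, Measurable (Z t)) {iStar : Ω → Fin N}
    (hiStar : Measurable iStar) :
    ∑ t ∈ Finset.Icc 1 T, ∫ ω, symbolErrorRate (x (I t ω)) (Z t ω) ∂μ -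
        ∑ t ∈ Finset.Icc 1 T, ∫ ω, symbolErrorRate (x (iStar ω)) (Z t ω) ∂μ ≤
      (4 / η₀ + 30) * (1 + Real.log T) *
        Real.sqrt (∑ i, ∑ t ∈ Finset.Icc 1 T, ∫ ω, symbolErrorRate (x i) (Z t ω) ∂μ) := by
  have hT0 : (1 : ℝ) ≤ T := by exact_mod_cast hT
  have hlog := Real.log_nonneg hT0
  have hΩ : Nonempty Ω := (inferInstance : NeZero μ).out |> fun h => by
    by_contra hne
    rw [not_nonempty_iff] at hne
    exact h (Measure.eq_zero_of_isEmpty μ)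
  have hN : (1 : ℝ) ≤ N := by exact_mod_cast (iStar hΩ.some).pos
  have hA := H.sum_integral_loss_le h0 h01 hx hZ
  have hB := fun κ hκ => H.regret_le_of_pos h0 (h01.trans (by norm_num)) hT hx hZ hiStar
    (κ := κ) hκ
  have hStar : 0 ≤ ∑ t ∈ Finset.Icc 1 T, ∫ ω, symbolErrorRate (x (iStar ω)) (Z t ω) ∂μ :=
    Finset.sum_nonneg fun t _ => integral_nonneg fun ω => (symbolErrorRate_mem _ (hx _) _).1
  have hS0 : 0 ≤ ∑ i, ∑ t ∈ Finset.Icc 1 T, ∫ ω, symbolErrorRate (x i) (Z t ω) ∂μ :=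
    Finset.sum_nonneg fun i _ => Finset.sum_nonneg fun t _ =>
      integral_nonneg fun ω => (symbolErrorRate_mem _ (hx _) _).1
  have hS1 : ∑ i, ∑ t ∈ Finset.Icc 1 T, ∫ ω, symbolErrorRate (x i) (Z t ω) ∂μ ≤ N * T := by
    have : ∀ i, ∀ t ∈ Finset.Icc 1 T, ∫ ω, symbolErrorRate (x i) (Z t ω) ∂μ ≤ 1 := fun i t ht =>
      (integral_mono (integrable_symbolErrorRate hx (hZ t ht) i) (integrable_const 1) fun ω =>
        (symbolErrorRate_mem _ (hx i) _).2.trans (by norm_num)).trans (by simp)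
    calc _ ≤ ∑ i : Fin N, ∑ t ∈ Finset.Icc 1 T, (1 : ℝ) :=
          Finset.sum_le_sum fun i _ => Finset.sum_le_sum (this i)
      _ = _ := by simp
  exact le_mul_sqrt_of_min_bounds h0 hN hlog hS0 hStar (div_le_one_of_le₀ hS1 (by positivity)) hA hB

end ExpectedRegret

end CodebookBandit

end

open CodebookBandit in
theorem corollary2 :
    ∀ η₀ : ℝ, 0 < η₀ → η₀ ≤ 1 / 162 →
    ∃ C : ℝ, 0 < C ∧ ∃ k : ℕ,
    ∀ (N d T : ℕ), 1 ≤ T →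
    ∀ (x : Fin N → Codebook 2 d), (∀ i, x i 0 ≠ x i 1) →
    ∀ (σ : ℕ → ℝ), (∀ t ∈ Finset.Icc 1 T, 0 < σ t) →
    ∀ (Ω : Type*) [MeasurableSpace Ω] (μ : Measure Ω) [IsProbabilityMeasure μ]
      (Z : ℕ → Ω → Signal d), (∀ t ∈ Finset.Icc 1 T, Measurable (Z t)) →
      (∀ t ∈ Finset.Icc 1 T,
        μ.map (Z t) = multivariateGaussian 0 (σ t ^ 2 • (1 : Matrix (Fin d) (Fin d) ℝ))) →
    ∀ (I : ℕ → Ω → Fin N) (w w' : ℕ → Ω → Fin N → ℝ) (η : ℕ → Ω → ℝ) (s : ℕ → Ω → ℕ),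
      IsCodebookLearner μ η₀ T x Z I w w' η s →
    ∀ (iStar : Ω → Fin N), Measurable iStar →
      (∀ ω i, ∑ t ∈ Finset.Icc 1 T, symbolErrorRate (x (iStar ω)) (Z t ω) ≤
        ∑ t ∈ Finset.Icc 1 T, symbolErrorRate (x i) (Z t ω)) →
    (1 / (T : ℝ)) * ∑ t ∈ Finset.Icc 1 T, expectedErrorProb μ (fun ω => x (I t ω)) (Z t) -
        (1 / (T : ℝ)) * ∑ t ∈ Finset.Icc 1 T,
          ∫ ω, symbolErrorRate (x (iStar ω)) (Z t ω) ∂μ ≤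
      C * (1 + Real.log T) ^ k *
        ((1 / (T : ℝ)) * Real.sqrt (∑ i : Fin N, ∑ t ∈ Finset.Icc 1 T,
            Real.sqrt (gaussianQ (‖x i 0 - x i 1‖ / (2 * σ t)) *
              (1 - gaussianQ (‖x i 0 - x i 1‖ / (2 * σ t))))) +
          (1 / (T : ℝ)) * Real.sqrt (∑ i : Fin N, ∑ t ∈ Finset.Icc 1 T, |σ t - σ (t - 1)|)) := by
  intro η₀ h0 h01
  refine ⟨4 / η₀ + 30, by positivity, 1, ?_⟩
  intro N d T hT x hx σ hσ Ω _ μ _ Z hZ hlaw I w w' η s H iStar hiStar _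
  have hreg := H.regret_le h0 h01 hT hx hZ hiStar
  have hloss : ∑ t ∈ Finset.Icc 1 T, expectedErrorProb μ (fun ω => x (I t ω)) (Z t) ≤
      ∑ t ∈ Finset.Icc 1 T, ∫ ω, symbolErrorRate (x (I t ω)) (Z t ω) ∂μ :=
    Finset.sum_le_sum fun t ht => expectedErrorProb_le x (hZ t ht) (H.measurable_choice t ht)
  have hS : ∑ i, ∑ t ∈ Finset.Icc 1 T, ∫ ω, symbolErrorRate (x i) (Z t ω) ∂μ ≤
      ∑ i : Fin N, ∑ t ∈ Finset.Icc 1 T, Real.sqrt (gaussianQ (‖x i 0 - x i 1‖ / (2 * σ t)) *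
        (1 - gaussianQ (‖x i 0 - x i 1‖ / (2 * σ t)))) := by
    refine Finset.sum_le_sum fun i _ => Finset.sum_le_sum fun t ht => ?_
    rw [integral_symbolErrorRate (x i) (hx i) (hσ t ht) (hZ t ht) (hlaw t ht)]
    have := hσ t ht
    exact gaussianQ_le_sqrt (by positivity)
  have hlog : 0 ≤ Real.log (T : ℝ) := Real.log_natCast_nonneg T
  have hsq := Real.sqrt_le_sqrt hS
  -- Nonnegativity is all that is needed of the path-length term, so `σ 0` may be arbitrary.
  have hV := Real.sqrt_nonneg (∑ i : Fin N, ∑ t ∈ Finset.Icc 1 T, |σ t - σ (t - 1)|)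
  have hc : 0 ≤ (4 / η₀ + 30) * (1 + Real.log (T : ℝ)) := by positivity
  rw [← mul_sub, ← mul_add, pow_one, mul_left_comm]
  refine mul_le_mul_of_nonneg_left ?_ (by positivity)
  refine (sub_le_sub_right hloss _).trans (hreg.trans ?_)
  exact mul_le_mul_of_nonneg_left (by linarith) hc
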